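/- For a finite simple graph $G$ with at least one vertex, let $r(v)$ be the sum of the degrees of the neighbours of the vertex $v$. A vertex $v$ that is not isolated is called a \emph{groupie} if the average degree $r(v)/\deg(v)$ of its neighbours is at least the average degree of all vertices of $G$; an isolated vertex is a groupie if and only if all vertices of $G$ are isolated. Let $0<p<1$, and let $B(n_1,n_2,p)$ be the random bipartite graph with parts of sizes $n_1$ and $n_2$ in which each of the $n_1n_2$ pairs with one vertex in each part is an edge with probability $p$, independently of the others. The proportion of groupies is the number of groupies divided by $n_1+n_2$. Let $\Phi$ be the distribution function of the standard normal distribution. (a) Let $n_1,n_2\to\infty$ with $n_1/n_2\to\alpha$, where $\alpha\in[0,\infty)$, and $|n_1-n_2|\to\infty$. Then the proportion of groupies in $B(n_1,n_2,p)$ converges in probability to $\dfrac{\max(1,\alpha)}{1+\alpha}$. (b) Let $n_1,n_2\to\infty$ with $n_1-n_2=c$, where $c$ is a fixed integer. Then the proportion of groupies in $B(n_1,n_2,p)$ converges in probability to $$L(c)=\tfrac12\Big(\Phi\big(1+\tfrac{pc}{2(1-p)}\big)+\Phi\big(1-\tfrac{pc}{2(1-p)}\big)\Big).$$ (c) For integers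 $c$, the limit $L(c)$ depends only on $|c|$ and is strictly decreasing in $|c|$; moreover $L(0)=\Phi(1)$ and $L(c)\to\tfrac12$ as $|c|\to\infty$. -/

import Mathlib

open Filter Topology MeasureTheory ProbabilityTheory

noncomputable section

namespace GroupieBipartite

/-- The average degree of all vertices of a finite graph. -/
def averageDegree {V : Type*} [Fintype V] (G : SimpleGraph V) [DecidableRel G.Adj] : ℝ :=
  (∑ w, (G.degree w : ℝ)) / (Fintype.card V : ℝ)

/-- `r(v)`: the sum of the degrees of the neighbours of `v`. -/
def neighborDegreeSum {V : Type*} [Fintype V] (G : SimpleGraph V) [DecidableRel G.Adj]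
    (v : V) : ℕ :=
  ∑ w ∈ G.neighborFinset v, G.degree w

/-- A non-isolated vertex `v` is a groupie if the average degree `r(v) / deg(v)` of its neighbours
is at least the average degree of all vertices; an isolated vertex is a groupie iff all vertices
are isolated. -/
def IsGroupie {V : Type*} [Fintype V] (G : SimpleGraph V) [DecidableRel G.Adj] (v : V) : Prop :=
  if G.degree v = 0 then ∀ w, G.degree w = 0
  else averageDegree G ≤ (neighborDegreeSum G v : ℝ) / (G.degree v : ℝ)

open Classical in
/-- The proportion of groupies among the vertices. -/
def groupieProportion {V : Type*} [Fintype V] (G : SimpleGraph V) : ℝ :=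
  ((Finset.univ.filter fun v => IsGroupie G v).card : ℝ) / (Fintype.card V : ℝ)

/-- The bipartite graph with parts `Fin n₁` and `Fin n₂` in which `i` in the first part is joined
to `j` in the second part iff `(i, j) ∈ E`. -/
def bipartiteGraph {n₁ n₂ : ℕ} (E : Set (Fin n₁ × Fin n₂)) : SimpleGraph (Fin n₁ ⊕ Fin n₂) where
  Adj
    | Sum.inl i, Sum.inr j => (i, j) ∈ E
    | Sum.inr j, Sum.inl i => (i, j) ∈ E
    | _, _ => False
  symm := ⟨by rintro (i | i) (j | j) h <;> exact h⟩
  loopless := ⟨by rintro (i | i) h <;> exact h⟩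

/-- The law of the random bipartite graph `B(n₁, n₂, p)`: each of the `n₁ * n₂` possible edges
between the parts is present with probability `p`, independently of the others. -/
def randomBipartite (n₁ n₂ : ℕ) (p : unitInterval) : Measure (SimpleGraph (Fin n₁ ⊕ Fin n₂)) :=
  (setBernoulli (Set.univ : Set (Fin n₁ × Fin n₂)) p).map bipartiteGraph

theorem measurable_bipartiteGraph {n₁ n₂ : ℕ} :
    Measurable (bipartiteGraph : Set (Fin n₁ × Fin n₂) → SimpleGraph (Fin n₁ ⊕ Fin n₂)) :=
  measurable_of_countable _

instance (n₁ n₂ : ℕ) (p : unitInterval) : IsProbabilityMeasure (randomBipartite n₁ n₂ p) :=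
  Measure.isProbabilityMeasure_map measurable_bipartiteGraph.aemeasurable

/-- The distribution function `Φ` of the standard normal distribution. -/
def stdNormalCDF (x : ℝ) : ℝ := cdf (gaussianReal 0 1) x

/-- `(Φ(1 + pc / (2(1 - p))) + Φ(1 - pc / (2(1 - p)))) / 2`. -/
def balancedLimit (p : ℝ) (c : ℤ) : ℝ :=
  (1 / 2) * (stdNormalCDF (1 + p * c / (2 * (1 - p))) + stdNormalCDF (1 - p * c / (2 * (1 - p))))

/-- The random variables `X G`, with `G` of law `B(n₁ k, n₂ k, p)`, converge in probability to the
constant `L` as `k → ∞`, where `X` is the proportion of groupies. -/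
def GroupieProportionTendsto (p : unitInterval) (n₁ n₂ : ℕ → ℕ) (L : ℝ) : Prop :=
  ∀ ε : ℝ, 0 < ε → Tendsto
    (fun k => randomBipartite (n₁ k) (n₂ k) p {G | ε < |groupieProportion G - L|}) atTop (𝓝 0)

end GroupieBipartite

end

/-!
Let `x` be the biadjacency matrix of the random bipartite graph, a matrix of independent Bernoulli
variables with `m` rows and `n` columns; the rows are the vertices of one part, and the other part
is treated in the same way by transposing. A row `i` that is not isolated is a groupie if and only
if its surplus `r(i) - d * deg(i)` is nonnegative, where `d` is the average degree of the graph
(`isGroupie_inl_iff`). Writing every entry as `p` plus a centred variable splits the surplus exactly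
(`surplus_eq`) into a fluctuation

  `∑ j, (x i j - p) * ∑ l, (x l j - p) - (∑ j, (x i j - p)) * (∑ j, ∑ l, (x l j - p)) / n`

and a drift `deg(i) * e * (m - n) / ((m + n) * n)`, where `e` is the number of edges.

If `|m - n|` tends to infinity, the drift wins. The fluctuation is at most of order `m + n` in mean,
while the drift has size about `p ^ 2 * n * m * |m - n| / (m + n)` unless the degree of `i` or the
number of edges is below half its mean. By Markov's inequality almost all vertices of the larger
part and almost none of the smaller part are groupies (`card_div_mul_measureReal_surplus_sign_le`,
`integral_abs_sum_indicator_sub_ite_div_le`).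

If `m - n = δ` is constant, the drift is close to `n * p ^ 2 * δ / 2`. In the fluctuation, the terms
with `l = i` add up to about `n * p * (1 - p)`, the second summand is negligible, and what remains
is the cross term `∑ j, (x i j - p) * ∑ l ≠ i, (x l j - p)`. The columns are independent, so a
central limit theorem with an explicit error (`norm_integral_exp_sum_sub_exp_le`) applies to it,
even jointly for two rows `i` and `i'` once the few terms with `l = i` or `l = i'` are split off:
divided by `n * p * (1 - p)`, the two cross terms are asymptotically independent standard normal
variables (`tendsto_charFun_crossTerm`). By Lévy's theorem and the portmanteau theorem on the plane,
two rows are groupies asymptotically independently, each with probability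
`Φ (1 + p * δ / (2 * (1 - p)))`
(`tendsto_charFun_surplus`, `tendsto_measureReal_nonneg_of_tendsto_charFun`). This holds uniformly
in the pair of rows, so the second moment method gives convergence of the proportion of groupies in
each part (`tendsto_integral_abs_sum_indicator_sub_div`). The two parts, with `δ = c` and `δ = -c`,
have asymptotically equal weights, whence `balancedLimit`.

The limit depends on `|c|` only by the symmetry `c ↦ -c`. It decreases in `|c|` because
`Φ (1 + y) + Φ (1 - y)` decreases in `y ≥ 0`: the normal density at `1 - y` exceeds that at `1 + y`
(`stdNormalCDF_add_lt`).
-/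

namespace GroupieBipartite

/-! ### Probability on finite spaces -/

/-- The columns of a matrix with independent entries are independent. -/
theorem iIndepFun_curry {Ω I J : Type*} [MeasurableSpace Ω] {μ : Measure Ω}
    [IsProbabilityMeasure μ] {x : I → J → Ω → ℝ} (hm : ∀ i j, Measurable (x i j))
    (h : iIndepFun (fun (a : J × I) => x a.2 a.1) μ) :
    iIndepFun (fun (j : J) (ω : Ω) (i : I) => x i j ω) μ := by
  have hm' : ∀ a : J × I, Measurable (x a.2 a.1) := fun a => hm _ _
  have h1 := (iIndepFun_iff_map_fun_eq_infinitePi_map hm').1 h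
  have hp : ∀ i j, IsProbabilityMeasure (μ.map (x i j)) := fun i j =>
    Measure.isProbabilityMeasure_map (hm i j).aemeasurable
  rw [iIndepFun_iff_map_fun_eq_infinitePi_map (fun j => measurable_pi_iff.2 fun i => hm i j)]
  have h2 : ∀ j, μ.map (fun ω i => x i j ω) = Measure.infinitePi fun i => μ.map (x i j) := by
    intro j
    have := h.precomp (g := fun i : I => (j, i)) (fun a b hab => by simpa using hab)
    exact (iIndepFun_iff_map_fun_eq_infinitePi_map (fun i => hm i j)).1 this
  simp_rw [h2]
  rw [← Measure.infinitePi_map_curry (fun j i => μ.map (x i j)), ← h1,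
    Measure.map_map (by fun_prop) (by fun_prop)]
  rfl

section Finite

variable {Ω : Type*} [MeasurableSpace Ω] [Finite Ω] [MeasurableSingletonClass Ω]
  {μ : Measure Ω} [IsProbabilityMeasure μ]

theorem integral_abs_le_sqrt (X : Ω → ℝ) : ∫ ω, |X ω| ∂μ ≤ √(∫ ω, X ω ^ 2 ∂μ) := by
  apply Real.le_sqrt_of_sq_le
  have h := variance_nonneg (fun ω => |X ω|) μ
  rw [variance_eq_sub (MemLp.of_discrete)] at h
  simpa using h

theorem integral_sq_sum_of_iIndepFun {ι : Type*} [Fintype ι] {Y : ι → Ω → ℝ} (h : iIndepFun Y μ)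
    (h0 : ∀ i, ∫ ω, Y i ω ∂μ = 0) :
    ∫ ω, (∑ i, Y i ω) ^ 2 ∂μ = ∑ i, ∫ ω, Y i ω ^ 2 ∂μ := by
  have h1 := IndepFun.variance_sum (μ := μ) (X := Y) (s := Finset.univ)
    (fun i _ => MemLp.of_discrete) (fun i _ j _ hij => h.indepFun hij)
  have h2 : ∫ ω, (∑ i, Y i) ω ∂μ = 0 := by
    simp only [Finset.sum_apply]
    rw [integral_finsetSum _ (fun i _ => Integrable.of_finite)]
    simp [h0]
  rw [variance_of_integral_eq_zero (by fun_prop) h2] at h1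
  simp only [Finset.sum_apply] at h1
  rw [h1]
  exact Finset.sum_congr rfl fun i _ => variance_of_integral_eq_zero (by fun_prop) (h0 i)

theorem integral_abs_sum_sub_le {ι : Type*} [Fintype ι] {Y : ι → Ω → ℝ} (h : iIndepFun Y μ)
    {a B : ℝ} (h0 : ∀ i, ∫ ω, Y i ω ∂μ = a) (h2 : ∀ i, ∫ ω, Y i ω ^ 2 ∂μ ≤ B) :
    ∫ ω, |(∑ i, Y i ω) - Fintype.card ι * a| ∂μ ≤ √(Fintype.card ι * B) := by
  have hc : iIndepFun (fun i ω => Y i ω - a) μ :=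
    h.comp (fun _ y => y - a) (fun _ => by fun_prop)
  have hs := integral_sq_sum_of_iIndepFun hc (fun i => by
    rw [integral_sub Integrable.of_finite Integrable.of_finite, h0]; simp)
  have he : ∀ ω, (∑ i, Y i ω) - Fintype.card ι * a = ∑ i, (Y i ω - a) := fun ω => by
    simp [Finset.sum_sub_distrib]
  simp_rw [he]
  refine (integral_abs_le_sqrt _).trans (Real.sqrt_le_sqrt ?_)
  rw [hs]
  calc ∑ i, ∫ ω, (Y i ω - a) ^ 2 ∂μ ≤ ∑ i : ι, B := by
        refine Finset.sum_le_sum fun i _ => ?_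
        have e : ∀ ω, (Y i ω - a) ^ 2 = Y i ω ^ 2 - 2 * a * Y i ω + a ^ 2 := fun ω => by ring
        simp_rw [e]
        rw [integral_add Integrable.of_finite Integrable.of_finite,
          integral_sub Integrable.of_finite Integrable.of_finite, integral_const_mul, h0]
        have := h2 i
        simp only [integral_const, probReal_univ, smul_eq_mul]
        nlinarith [sq_nonneg a]
    _ = _ := by simp

/-- The fourth moment of a sum of independent centred variables bounded by `1` is at most three
times the square of the number of terms, as for Gaussian variables of the same variance. -/
theorem integral_pow_four_sum_le {ι : Type*} {Y : ι → Ω → ℝ} (h : iIndepFun Y μ)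
    (h0 : ∀ i, ∫ ω, Y i ω ∂μ = 0) (hb : ∀ i ω, |Y i ω| ≤ 1) (s : Finset ι) :
    ∫ ω, (∑ i ∈ s, Y i ω) ∂μ = 0 ∧ ∫ ω, (∑ i ∈ s, Y i ω) ^ 2 ∂μ ≤ s.card ∧
      ∫ ω, (∑ i ∈ s, Y i ω) ^ 4 ∂μ ≤ 3 * (s.card : ℝ) ^ 2 := by
  classical
  induction s using Finset.induction with
  | empty => simp
  | insert i s hi ih =>
    obtain ⟨i1, i2, i4⟩ := ih
    have hind : IndepFun (fun ω => ∑ j ∈ s, Y j ω) (Y i) μ := by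
      have := h.indepFun_finsetSum_of_notMem (fun _ => Measurable.of_discrete) hi
      convert this using 1
      ext; simp
    set S : Ω → ℝ := fun ω => ∑ j ∈ s, Y j ω with hS
    have hpow : ∀ a b : ℕ, ∫ ω, S ω ^ a * Y i ω ^ b ∂μ =
        (∫ ω, S ω ^ a ∂μ) * ∫ ω, Y i ω ^ b ∂μ := fun a b =>
      hind.integral_fun_comp_mul_comp (f := fun x : ℝ => x ^ a) (g := fun x : ℝ => x ^ b)
        (by fun_prop) (by fun_prop) (by fun_prop) (by fun_prop)
    have hsq : ∀ ω, Y i ω ^ 2 ≤ 1 := fun ω => (sq_le_one_iff_abs_le_one _).2 (hb i ω)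
    have hY2 : ∫ ω, Y i ω ^ 2 ∂μ ≤ 1 := by
      calc _ ≤ ∫ _ω : Ω, (1 : ℝ) ∂μ :=
            integral_mono Integrable.of_finite Integrable.of_finite hsq
        _ = 1 := by simp
    have hY4 : ∫ ω, Y i ω ^ 4 ∂μ ≤ 1 := by
      calc _ ≤ ∫ _ω : Ω, (1 : ℝ) ∂μ :=
            integral_mono Integrable.of_finite Integrable.of_finite fun ω => by
              have := hsq ω
              have h' := sq_nonneg (Y i ω)
              simp only
              nlinarith
        _ = 1 := by simp
    have hS2 : 0 ≤ ∫ ω, S ω ^ 2 ∂μ := integral_nonneg fun ω => sq_nonneg _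
    have hY2' : 0 ≤ ∫ ω, Y i ω ^ 2 ∂μ := integral_nonneg fun ω => sq_nonneg _
    have h11 := hpow 1 1
    have h31 := hpow 3 1
    have h22 := hpow 2 2
    have h13 := hpow 1 3
    simp only [pow_one] at h11 h31 h13
    rw [i1, h0] at h11
    rw [h0] at h31
    rw [i1] at h13
    simp only [Finset.sum_insert hi, Finset.card_insert_of_notMem hi, Nat.cast_add, Nat.cast_one]
    refine ⟨?_, ?_, ?_⟩
    · rw [integral_add Integrable.of_finite Integrable.of_finite, h0, i1, add_zero]
    · have e : ∀ ω, (Y i ω + ∑ j ∈ s, Y j ω) ^ 2 =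
          Y i ω ^ 2 + S ω ^ 2 + 2 * (S ω * Y i ω) := fun ω => by rw [hS]; ring
      simp_rw [e]
      rw [integral_add Integrable.of_finite Integrable.of_finite,
        integral_add Integrable.of_finite Integrable.of_finite, integral_const_mul, h11]
      linarith
    · have e : ∀ ω, (Y i ω + ∑ j ∈ s, Y j ω) ^ 4 =
          Y i ω ^ 4 + S ω ^ 4 + 4 * (S ω ^ 3 * Y i ω) + 6 * (S ω ^ 2 * Y i ω ^ 2) +
            4 * (S ω * Y i ω ^ 3) := fun ω => by rw [hS]; ring
      simp_rw [e]
      rw [integral_add Integrable.of_finite Integrable.of_finite,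
        integral_add Integrable.of_finite Integrable.of_finite,
        integral_add Integrable.of_finite Integrable.of_finite,
        integral_add Integrable.of_finite Integrable.of_finite, integral_const_mul,
        integral_const_mul, integral_const_mul, h31, h22, h13]
      nlinarith [mul_le_mul i2 hY2 hY2' (Nat.cast_nonneg s.card)]

theorem integral_abs_mul_le {X Y : Ω → ℝ} {A B : ℝ} (hA : 0 < A) (hB : 0 < B)
    (hX : ∫ ω, X ω ^ 2 ∂μ ≤ A) (hY : ∫ ω, Y ω ^ 2 ∂μ ≤ B) :
    ∫ ω, |X ω * Y ω| ∂μ ≤ √(A * B) := by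
  have hA' := Real.sqrt_pos.2 hA
  have hB' := Real.sqrt_pos.2 hB
  have key : ∀ ω, |X ω * Y ω| ≤ (√B / √A * X ω ^ 2 + √A / √B * Y ω ^ 2) / 2 := fun ω => by
    have e : √B / √A * X ω ^ 2 + √A / √B * Y ω ^ 2 - 2 * |X ω * Y ω| =
        (√B * |X ω| - √A * |Y ω|) ^ 2 / (√A * √B) := by
      rw [abs_mul, ← sq_abs (X ω), ← sq_abs (Y ω)]
      field_simp
      ring
    have : 0 ≤ (√B * |X ω| - √A * |Y ω|) ^ 2 / (√A * √B) := by positivity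
    linarith
  calc _ ≤ ∫ ω, (√B / √A * X ω ^ 2 + √A / √B * Y ω ^ 2) / 2 ∂μ :=
        integral_mono Integrable.of_finite Integrable.of_finite key
    _ = (√B / √A * ∫ ω, X ω ^ 2 ∂μ + √A / √B * ∫ ω, Y ω ^ 2 ∂μ) / 2 := by
        rw [integral_div, integral_add Integrable.of_finite Integrable.of_finite,
          integral_const_mul, integral_const_mul]
    _ ≤ (√B / √A * √A ^ 2 + √A / √B * √B ^ 2) / 2 := by
        rw [Real.sq_sqrt hA.le, Real.sq_sqrt hB.le]; gcongr
    _ = √(A * B) := by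
        rw [Real.sqrt_mul hA.le]; field_simp; ring

/-- Markov's inequality in terms of real-valued probabilities. -/
theorem measureReal_abs_ge_le {t : ℝ} (ht : 0 < t) (X : Ω → ℝ) :
    μ.real {ω | t ≤ |X ω|} ≤ (∫ ω, |X ω| ∂μ) / t := by
  rw [le_div_iff₀ ht, mul_comm]
  exact mul_meas_ge_le_integral_of_nonneg (ae_of_all _ fun ω => abs_nonneg _)
    Integrable.of_finite t

/-! ### A central limit theorem with an explicit error -/

/-- Replacing the factors of a product in the unit disc one by one. -/
theorem norm_prod_sub_prod_le {ι : Type*} (s : Finset ι) {f g : ι → ℂ} (hf : ∀ i, ‖f i‖ ≤ 1)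
    (hg : ∀ i, ‖g i‖ ≤ 1) : ‖∏ i ∈ s, f i - ∏ i ∈ s, g i‖ ≤ ∑ i ∈ s, ‖f i - g i‖ := by
  classical
  induction s using Finset.induction with
  | empty => simp
  | insert i s hi ih =>
    rw [Finset.prod_insert hi, Finset.prod_insert hi, Finset.sum_insert hi]
    have hp : ‖∏ i ∈ s, f i‖ ≤ 1 := by
      rw [norm_prod]
      exact Finset.prod_le_one (fun _ _ => norm_nonneg _) fun i _ => hf i
    calc ‖f i * ∏ i ∈ s, f i - g i * ∏ i ∈ s, g i‖
        = ‖(f i - g i) * ∏ i ∈ s, f i + g i * (∏ i ∈ s, f i - ∏ i ∈ s, g i)‖ := by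
          congr 1; ring
      _ ≤ ‖f i - g i‖ * ‖∏ i ∈ s, f i‖ + ‖g i‖ * ‖∏ i ∈ s, f i - ∏ i ∈ s, g i‖ := by
          refine (norm_add_le _ _).trans ?_
          rw [norm_mul, norm_mul]
      _ ≤ ‖f i - g i‖ * 1 + 1 * ∑ i ∈ s, ‖f i - g i‖ := by
          gcongr
          exact hg i
      _ = _ := by ring

theorem norm_exp_mul_I_sub_taylor_le (y : ℝ) :
    ‖Complex.exp (y * Complex.I) - (1 + y * Complex.I - y ^ 2 / 2)‖ ≤ 4 * |y| ^ 3 := by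
  have hn : ‖(y : ℂ) * Complex.I‖ = |y| := by simp
  rcases le_total |y| 1 with hy | hy
  · have h := Complex.norm_exp_sub_sum_le_norm_mul_exp ((y : ℂ) * Complex.I) 3
    rw [hn] at h
    have e : ∑ m ∈ Finset.range 3, ((y : ℂ) * Complex.I) ^ m / m.factorial =
        1 + y * Complex.I - y ^ 2 / 2 := by
      simp [Finset.sum_range_succ, mul_pow, Nat.factorial]
      ring
    rw [e] at h
    refine h.trans ?_
    have h3 : Real.exp |y| ≤ 4 :=
      (Real.exp_le_exp.2 hy).trans (by linarith [Real.exp_one_lt_d9])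
    nlinarith [pow_nonneg (abs_nonneg y) 3]
  · calc ‖Complex.exp (y * Complex.I) - (1 + y * Complex.I - y ^ 2 / 2)‖
        ≤ ‖Complex.exp (y * Complex.I)‖ + (‖(1 : ℂ)‖ + ‖(y : ℂ) * Complex.I‖ +
            ‖(y : ℂ) ^ 2 / 2‖) := by
          refine (norm_sub_le _ _).trans (add_le_add le_rfl ?_)
          exact (norm_sub_le _ _).trans (add_le_add (norm_add_le _ _) le_rfl)
      _ = 1 + (1 + |y| + |y| ^ 2 / 2) := by
          rw [hn, Complex.norm_exp_ofReal_mul_I]; simp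
      _ ≤ 4 * |y| ^ 3 := by
          have h2 : 1 ≤ |y| ^ 2 := one_le_pow₀ hy
          nlinarith

/-- The characteristic function of a single centred variable of variance `v` compared with that of
a normal variable; only second and fourth moments enter. -/
theorem norm_integral_exp_mul_I_sub_exp_le {Y : Ω → ℝ} {v w c : ℝ} (hc : 0 < c)
    (h0 : ∫ ω, Y ω ∂μ = 0) (h2 : ∫ ω, Y ω ^ 2 ∂μ = v) (h4 : ∫ ω, Y ω ^ 4 ∂μ ≤ w) :
    ‖∫ ω, Complex.exp (Y ω * Complex.I) ∂μ - Complex.exp (-(v / 2) : ℝ)‖ ≤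
      2 * (c * v + w / c) + v ^ 2 := by
  have hv : 0 ≤ v := h2 ▸ integral_nonneg fun ω => sq_nonneg _
  -- the third absolute moment is controlled by the second and the fourth
  have key : ∀ y : ℝ, 4 * |y| ^ 3 ≤ 2 * (c * y ^ 2 + y ^ 4 / c) := fun y => by
    have e : 2 * (c * y ^ 2 + y ^ 4 / c) - 4 * |y| ^ 3 = 2 * |y| ^ 2 / c * (c - |y|) ^ 2 := by
      have h' : y ^ 4 = |y| ^ 4 := (Even.pow_abs (by decide) y).symm
      rw [← sq_abs y, h']
      field_simp
      ring
    have : 0 ≤ 2 * |y| ^ 2 / c * (c - |y|) ^ 2 := by positivity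
    linarith
  have hI : ∫ ω, (1 + (Y ω : ℂ) * Complex.I - (Y ω : ℂ) ^ 2 / 2) ∂μ = ((1 - v / 2 : ℝ) : ℂ) := by
    rw [integral_sub Integrable.of_finite Integrable.of_finite,
      integral_add Integrable.of_finite Integrable.of_finite, integral_mul_const,
      integral_complex_ofReal, h0, integral_div]
    have : ∫ ω, (Y ω : ℂ) ^ 2 ∂μ = (v : ℂ) := by
      rw [← h2, ← integral_complex_ofReal]
      simp
    rw [this]
    simp
  have h1 : ‖∫ ω, Complex.exp (Y ω * Complex.I) ∂μ - ((1 - v / 2 : ℝ) : ℂ)‖ ≤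
      2 * (c * v + w / c) := by
    rw [← hI, ← integral_sub Integrable.of_finite Integrable.of_finite]
    refine (norm_integral_le_integral_norm _).trans ?_
    calc _ ≤ ∫ ω, 2 * (c * Y ω ^ 2 + Y ω ^ 4 / c) ∂μ :=
          integral_mono Integrable.of_finite Integrable.of_finite fun ω =>
            (norm_exp_mul_I_sub_taylor_le (Y ω)).trans (key _)
      _ = 2 * (c * v + (∫ ω, Y ω ^ 4 ∂μ) / c) := by
          rw [integral_const_mul, integral_add Integrable.of_finite Integrable.of_finite,
            integral_const_mul, integral_div, h2]
      _ ≤ _ := by gcongr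
  have h3 : ‖((1 - v / 2 : ℝ) : ℂ) - Complex.exp (-(v / 2) : ℝ)‖ ≤ v ^ 2 := by
    rw [← Complex.ofReal_exp, ← Complex.ofReal_sub, Complex.norm_real, Real.norm_eq_abs, abs_le]
    have ha := Real.add_one_le_exp (-(v / 2))
    have hb := Real.add_one_le_exp (v / 2)
    have hd : Real.exp (-(v / 2)) * Real.exp (v / 2) = 1 := by rw [← Real.exp_add]; simp
    have he := Real.exp_pos (-(v / 2))
    have hf : Real.exp (-(v / 2)) * (1 + v / 2) ≤ 1 := by nlinarith
    constructor
    · by_contra hcon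
      push Not at hcon
      nlinarith [sq_nonneg v, mul_nonneg hv hv, mul_nonneg (mul_nonneg hv hv) hv]
    · nlinarith [sq_nonneg v]
  calc _ ≤ _ := norm_sub_le_norm_sub_add_norm_sub _ ((1 - v / 2 : ℝ) : ℂ) _
    _ ≤ _ := add_le_add h1 h3

/-- A central limit theorem with an explicit error, for sums of independent centred variables with
common variance `v`: the error is small when `c` balances the second and fourth moments. -/
theorem norm_integral_exp_sum_sub_exp_le {ι : Type*} [Fintype ι] {Y : ι → Ω → ℝ} {v w c : ℝ}
    (h : iIndepFun Y μ) (hc : 0 < c) (h0 : ∀ i, ∫ ω, Y i ω ∂μ = 0)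
    (h2 : ∀ i, ∫ ω, Y i ω ^ 2 ∂μ = v) (h4 : ∀ i, ∫ ω, Y i ω ^ 4 ∂μ ≤ w) :
    ‖∫ ω, Complex.exp ((∑ i, Y i ω : ℝ) * Complex.I) ∂μ -
        Complex.exp (-(Fintype.card ι * v / 2) : ℝ)‖ ≤
      Fintype.card ι * (2 * (c * v + w / c) + v ^ 2) := by
  have e1 : ∫ ω, Complex.exp ((∑ i, Y i ω : ℝ) * Complex.I) ∂μ =
      ∏ i, ∫ ω, Complex.exp (Y i ω * Complex.I) ∂μ := by
    rw [← h.integral_fun_prod_comp (f := fun _ (y : ℝ) => Complex.exp (y * Complex.I))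
      (fun i => by fun_prop) (fun i => by fun_prop)]
    simp_rw [← Complex.exp_sum, Complex.ofReal_sum, Finset.sum_mul]
  have e2 : Complex.exp (-(Fintype.card ι * v / 2) : ℝ) =
      ∏ _i : ι, Complex.exp (-(v / 2) : ℝ) := by
    rw [Finset.prod_const, ← Complex.exp_nat_mul, Finset.card_univ]
    congr 1
    push_cast
    ring
  rw [e1, e2]
  refine (norm_prod_sub_prod_le _ (fun i => ?_) (fun i => ?_)).trans ?_
  · refine (norm_integral_le_integral_norm _).trans ?_
    simp [Complex.norm_exp_ofReal_mul_I]
  · have hv : 0 ≤ v := h2 i ▸ integral_nonneg fun ω => sq_nonneg _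
    rw [← Complex.ofReal_exp, Complex.norm_real, Real.norm_eq_abs, Real.abs_exp,
      Real.exp_le_one_iff]
    linarith
  · calc _ ≤ ∑ _i : ι, (2 * (c * v + w / c) + v ^ 2) :=
          Finset.sum_le_sum fun i _ => norm_integral_exp_mul_I_sub_exp_le hc (h0 i) (h2 i) (h4 i)
      _ = _ := by rw [Finset.sum_const, nsmul_eq_mul, Finset.card_univ]

end Finite

/-! ### Random zero-one matrices -/

/-- The surplus of row `i` of a matrix `x`: when `x` is the biadjacency matrix of a bipartite graph,
this is `r(i) - d * deg(i)`, where `d` is the average degree of the graph. -/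
noncomputable def surplus {I J : Type*} [Fintype I] [Fintype J] (x : I → J → ℝ) (i : I) : ℝ :=
  ∑ j, x i j * ∑ l, x l j -
    2 * (∑ j, ∑ l, x l j) * (∑ j, x i j) / (Fintype.card I + Fintype.card J)

/-- Centring all entries of the matrix at `p` decomposes the surplus into a fluctuation and a drift
proportional to the difference of the numbers of rows and columns. -/
theorem surplus_eq {I J : Type*} [Fintype I] [Fintype J] [Nonempty J] (x : I → J → ℝ) (p : ℝ)
    (i : I) :
    surplus x i = ∑ j, (x i j - p) * ∑ l, (x l j - p) -
        (∑ j, (x i j - p)) * (∑ j, ∑ l, (x l j - p)) / Fintype.card J +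
      (∑ j, x i j) * (∑ j, ∑ l, x l j) * ((Fintype.card I : ℝ) - Fintype.card J) /
        ((Fintype.card I + Fintype.card J) * Fintype.card J) := by
  have hn : (0 : ℝ) < Fintype.card J := by exact_mod_cast Fintype.card_pos
  have hm : (0 : ℝ) ≤ Fintype.card I := Nat.cast_nonneg _
  have e : ∑ j, (x i j - p) * ∑ l, (x l j - p) = ∑ j, x i j * ∑ l, x l j
      - p * (∑ j, ∑ l, x l j) - Fintype.card I * p * (∑ j, x i j)
      + Fintype.card J * (Fintype.card I * p ^ 2) := by
    have : ∀ j, (x i j - p) * ∑ l, (x l j - p) = x i j * ∑ l, x l j - p * ∑ l, x l j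
        - Fintype.card I * p * x i j + Fintype.card I * p ^ 2 := fun j => by
      simp [Finset.sum_sub_distrib]
      ring
    simp_rw [this]
    rw [Finset.sum_add_distrib, Finset.sum_sub_distrib, Finset.sum_sub_distrib, Finset.mul_sum,
      Finset.mul_sum]
    simp
  rw [surplus, e]
  simp only [Finset.sum_sub_distrib, Finset.sum_const, Finset.card_univ, nsmul_eq_mul]
  field_simp
  ring

/-- The contribution to the fluctuation of the surplus of row `i` of the entries in the rows
from `s`, with all entries centred at `p`. -/
noncomputable def crossTerm {Ω I J : Type*} [Fintype J] (x : I → J → Ω → ℝ) (p : ℝ) (s : Finset I)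
    (i : I) (ω : Ω) : ℝ :=
  ∑ j, (x i j ω - p) * ∑ l ∈ s, (x l j ω - p)

/-- The entries of `x` are independent Bernoulli variables with parameter `p`. -/
structure IsBernoulliMatrix {Ω I J : Type*} [MeasurableSpace Ω] (μ : Measure Ω) (p : ℝ)
    (x : I → J → Ω → ℝ) : Prop where
  zero_or_one : ∀ i j ω, x i j ω = 0 ∨ x i j ω = 1
  indep : iIndepFun (fun a : I × J => x a.1 a.2) μ
  integral_eq : ∀ i j, ∫ ω, x i j ω ∂μ = p

namespace IsBernoulliMatrix

variable {Ω : Type*} [MeasurableSpace Ω] {μ : Measure Ω} {I J : Type*} {p : ℝ}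
  {x : I → J → Ω → ℝ}

theorem transpose (h : IsBernoulliMatrix μ p x) : IsBernoulliMatrix μ p fun j i => x i j where
  zero_or_one j i ω := h.zero_or_one i j ω
  indep := h.indep.precomp (g := Prod.swap) Prod.swap_injective
  integral_eq j i := h.integral_eq i j

theorem indep_centred (h : IsBernoulliMatrix μ p x) :
    iIndepFun (fun (a : I × J) (ω : Ω) => x a.1 a.2 ω - p) μ :=
  h.indep.comp (fun _ y => y - p) fun _ => by fun_prop

theorem abs_centred_le (h : IsBernoulliMatrix μ p x) (hp₀ : 0 ≤ p) (hp₁ : p ≤ 1) (i : I) (j : J)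
    (ω : Ω) : |x i j ω - p| ≤ 1 := by
  rw [abs_le]
  rcases h.zero_or_one i j ω with h | h <;> rw [h] <;> constructor <;> linarith

variable [Finite Ω] [MeasurableSingletonClass Ω] [IsProbabilityMeasure μ]

theorem indep_columns (h : IsBernoulliMatrix μ p x) :
    iIndepFun (fun (j : J) (ω : Ω) (i : I) => x i j ω) μ :=
  iIndepFun_curry (fun _ _ => Measurable.of_discrete) h.transpose.indep

theorem integral_centred (h : IsBernoulliMatrix μ p x) (i : I) (j : J) :
    ∫ ω, (x i j ω - p) ∂μ = 0 := by
  rw [integral_sub Integrable.of_finite Integrable.of_finite, h.integral_eq]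
  simp

theorem integral_centred_sq (h : IsBernoulliMatrix μ p x) (i : I) (j : J) :
    ∫ ω, (x i j ω - p) ^ 2 ∂μ = p * (1 - p) := by
  have e : ∀ ω, (x i j ω - p) ^ 2 = (1 - 2 * p) * x i j ω + p ^ 2 := fun ω => by
    rcases h.zero_or_one i j ω with h | h <;> rw [h] <;> ring
  simp_rw [e]
  rw [integral_add Integrable.of_finite Integrable.of_finite, integral_const_mul, h.integral_eq]
  simp
  ring

theorem integral_centred_mul (h : IsBernoulliMatrix μ p x) {i l : I} (hil : i ≠ l) (j : J) :
    ∫ ω, (x i j ω - p) * (x l j ω - p) ∂μ = 0 := by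
  have hi : IndepFun (fun ω => x i j ω - p) (fun ω => x l j ω - p) μ :=
    h.indep_centred.indepFun (i := (i, j)) (j := (l, j)) (by simp [hil])
  rw [hi.integral_fun_mul_eq_mul_integral (by fun_prop) (by fun_prop), h.integral_centred]
  simp

theorem column_moments (h : IsBernoulliMatrix μ p x) (hp₀ : 0 ≤ p) (hp₁ : p ≤ 1) (s : Finset I)
    (j : J) : ∫ ω, (∑ l ∈ s, (x l j ω - p)) ∂μ = 0 ∧
      ∫ ω, (∑ l ∈ s, (x l j ω - p)) ^ 2 ∂μ ≤ s.card ∧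
      ∫ ω, (∑ l ∈ s, (x l j ω - p)) ^ 4 ∂μ ≤ 3 * (s.card : ℝ) ^ 2 :=
  integral_pow_four_sum_le (Y := fun l ω => x l j ω - p)
    (h.indep_centred.precomp (g := fun l => (l, j)) (fun a b hab => by simpa using hab))
    (fun l => h.integral_centred l j) (fun l => h.abs_centred_le hp₀ hp₁ l j) s

theorem integral_sq_row_le [Fintype J] (h : IsBernoulliMatrix μ p x) (hp₀ : 0 ≤ p) (hp₁ : p ≤ 1)
    (i : I) :
    ∫ ω, (∑ j, (x i j ω - p)) ^ 2 ∂μ ≤ Fintype.card J :=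
  (integral_pow_four_sum_le (Y := fun j ω => x i j ω - p)
    (h.indep_centred.precomp (g := fun j => (i, j)) (fun a b hab => by simpa using hab))
    (fun j => h.integral_centred i j) (fun j => h.abs_centred_le hp₀ hp₁ i j) Finset.univ).2.1

theorem integral_abs_row_le [Fintype J] (h : IsBernoulliMatrix μ p x) (hp₀ : 0 ≤ p) (hp₁ : p ≤ 1)
    (i : I) :
    ∫ ω, |∑ j, (x i j ω - p)| ∂μ ≤ √(Fintype.card J) :=
  (integral_abs_le_sqrt _).trans (Real.sqrt_le_sqrt (h.integral_sq_row_le hp₀ hp₁ i))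

/-- A row sum is rarely at most half its mean. In particular few vertices of the random graph are
isolated. -/
theorem measureReal_row_le (h : IsBernoulliMatrix μ p x) (hp₀ : 0 < p) (hp₁ : p ≤ 1)
    [Fintype J] [Nonempty J] (i : I) :
    μ.real {ω | ∑ j, x i j ω ≤ p * Fintype.card J / 2} ≤ 2 / (p * √(Fintype.card J)) := by
  have hn : (0 : ℝ) < Fintype.card J := by exact_mod_cast Fintype.card_pos
  calc _ ≤ μ.real {ω | p * Fintype.card J / 2 ≤ |∑ j, (x i j ω - p)|} :=
        measureReal_mono fun ω hω => by
          simp only [Set.mem_ofPred_eq, Finset.sum_sub_distrib, Finset.sum_const, Finset.card_univ,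
            nsmul_eq_mul] at hω ⊢
          rw [le_abs]
          right
          linarith
    _ ≤ √(Fintype.card J) / (p * Fintype.card J / 2) :=
        (measureReal_abs_ge_le (by positivity) _).trans
          (div_le_div_of_nonneg_right (h.integral_abs_row_le hp₀.le hp₁ i) (by positivity))
    _ = _ := by
        have := Real.mul_self_sqrt hn.le
        have hs := Real.sqrt_pos.2 hn
        field_simp
        linarith

section Moments

variable [Fintype I] [Fintype J]

theorem integral_sq_total_le (h : IsBernoulliMatrix μ p x) (hp₀ : 0 ≤ p) (hp₁ : p ≤ 1) :
    ∫ ω, (∑ j, ∑ l, (x l j ω - p)) ^ 2 ∂μ ≤ Fintype.card J * Fintype.card I := by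
  have := (integral_pow_four_sum_le (Y := fun (a : J × I) ω => x a.2 a.1 ω - p)
    h.transpose.indep_centred (fun a => h.integral_centred a.2 a.1)
    (fun a => h.abs_centred_le hp₀ hp₁ a.2 a.1) Finset.univ).2.1
  simpa only [Fintype.sum_prod_type, Finset.card_univ, Fintype.card_prod, Nat.cast_mul] using this

theorem integral_abs_total_le (h : IsBernoulliMatrix μ p x) (hp₀ : 0 ≤ p) (hp₁ : p ≤ 1) :
    ∫ ω, |∑ j, ∑ l, (x l j ω - p)| ∂μ ≤ √(Fintype.card J * Fintype.card I) :=
  (integral_abs_le_sqrt _).trans (Real.sqrt_le_sqrt (h.integral_sq_total_le hp₀ hp₁))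

theorem integral_abs_row_mul_total_le [Nonempty I] [Nonempty J] (h : IsBernoulliMatrix μ p x)
    (hp₀ : 0 ≤ p) (hp₁ : p ≤ 1) (i : I) :
    ∫ ω, |(∑ j, (x i j ω - p)) * (∑ j, ∑ l, (x l j ω - p)) / Fintype.card J| ∂μ ≤
      √(Fintype.card I) := by
  have hn : (0 : ℝ) < Fintype.card J := by exact_mod_cast Fintype.card_pos
  have hm : (0 : ℝ) < Fintype.card I := by exact_mod_cast Fintype.card_pos
  have := integral_abs_mul_le hn (mul_pos hn hm) (h.integral_sq_row_le hp₀ hp₁ i)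
    (h.integral_sq_total_le hp₀ hp₁)
  simp_rw [abs_div]
  rw [integral_div, abs_of_pos hn, div_le_iff₀ hn]
  refine this.trans_eq ?_
  rw [← mul_assoc, Real.sqrt_mul (by positivity), Real.sqrt_mul_self hn.le, mul_comm]

/-- The correlation of a row with the column sums: the diagonal terms contribute `p (1 - p)` for
each column. -/
theorem integral_abs_row_dot_columns_le [Nonempty I] (h : IsBernoulliMatrix μ p x) (hp₀ : 0 ≤ p)
    (hp₁ : p ≤ 1) (i : I) :
    ∫ ω, |∑ j, (x i j ω - p) * ∑ l, (x l j ω - p)| ∂μ ≤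
      Fintype.card J + √(Fintype.card J * Fintype.card I) := by
  classical
  have hind : iIndepFun (fun j ω => (x i j ω - p) * ∑ l, (x l j ω - p)) μ :=
    h.indep_columns.comp (fun _ (y : I → ℝ) => (y i - p) * ∑ l, (y l - p)) fun _ => by fun_prop
  have h1 : ∀ j, ∫ ω, (x i j ω - p) * ∑ l, (x l j ω - p) ∂μ = p * (1 - p) := fun j => by
    simp_rw [Finset.mul_sum]
    rw [integral_finsetSum _ fun _ _ => Integrable.of_finite, Finset.sum_eq_single i]
    · simp_rw [← sq]
      exact h.integral_centred_sq i j
    · intro l _ hl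
      exact h.integral_centred_mul hl.symm j
    · simp
  have h2 : ∀ j, ∫ ω, ((x i j ω - p) * ∑ l, (x l j ω - p)) ^ 2 ∂μ ≤ Fintype.card I := fun j => by
    calc _ ≤ ∫ ω, (∑ l, (x l j ω - p)) ^ 2 ∂μ :=
          integral_mono Integrable.of_finite Integrable.of_finite fun ω => by
            have := (sq_le_one_iff_abs_le_one _).2 (h.abs_centred_le hp₀ hp₁ i j ω)
            simp only [mul_pow]
            nlinarith [sq_nonneg (∑ l, (x l j ω - p))]
      _ ≤ _ := (h.column_moments hp₀ hp₁ Finset.univ j).2.1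
  have h3 := integral_abs_sum_sub_le hind h1 h2
  have hn : (0 : ℝ) ≤ Fintype.card J := Nat.cast_nonneg _
  calc _ ≤ ∫ ω, (|(∑ j, (x i j ω - p) * ∑ l, (x l j ω - p)) - Fintype.card J * (p * (1 - p))| +
            Fintype.card J) ∂μ :=
        integral_mono Integrable.of_finite Integrable.of_finite fun ω => by
          have h4 : |Fintype.card J * (p * (1 - p))| ≤ (Fintype.card J : ℝ) := by
            rw [abs_of_nonneg (mul_nonneg hn (mul_nonneg hp₀ (by linarith)))]
            exact mul_le_of_le_one_right hn (by nlinarith)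
          have := abs_sub_abs_le_abs_sub (∑ j, (x i j ω - p) * ∑ l, (x l j ω - p))
            (Fintype.card J * (p * (1 - p)))
          simp only
          linarith
    _ ≤ _ := by
        rw [integral_add Integrable.of_finite Integrable.of_finite]
        simp only [integral_const, probReal_univ, smul_eq_mul, one_mul]
        linarith

theorem measureReal_total_le (h : IsBernoulliMatrix μ p x) (hp₀ : 0 < p) (hp₁ : p ≤ 1)
    [Nonempty I] [Nonempty J] :
    μ.real {ω | ∑ j, ∑ l, x l j ω ≤ p * (Fintype.card J * Fintype.card I) / 2} ≤
      2 / (p * √(Fintype.card J * Fintype.card I)) := by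
  have hn : (0 : ℝ) < Fintype.card J := by exact_mod_cast Fintype.card_pos
  have hm : (0 : ℝ) < Fintype.card I := by exact_mod_cast Fintype.card_pos
  have hnm := mul_pos hn hm
  calc _ ≤ μ.real {ω | p * (Fintype.card J * Fintype.card I) / 2 ≤
          |∑ j, ∑ l, (x l j ω - p)|} :=
        measureReal_mono fun ω hω => by
          simp only [Set.mem_ofPred_eq, Finset.sum_sub_distrib, Finset.sum_const, Finset.card_univ,
            nsmul_eq_mul] at hω ⊢
          rw [le_abs]
          right
          linarith
    _ ≤ √(Fintype.card J * Fintype.card I) / (p * (Fintype.card J * Fintype.card I) / 2) :=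
        (measureReal_abs_ge_le (by positivity) _).trans
          (div_le_div_of_nonneg_right (h.integral_abs_total_le hp₀.le hp₁) (by positivity))
    _ = _ := by
        have := Real.mul_self_sqrt hnm.le
        have hs := Real.sqrt_pos.2 hnm
        field_simp
        linarith

end Moments

end IsBernoulliMatrix

namespace IsBernoulliMatrix

variable {Ω : Type*} [MeasurableSpace Ω] {μ : Measure Ω} {I J : Type*} {p : ℝ}
  {x : I → J → Ω → ℝ} [Finite Ω] [MeasurableSingletonClass Ω] [IsProbabilityMeasure μ]

/-! ### Parts of very different sizes -/

/-- When the numbers `m` of rows and `n` of columns differ, the drift fixes the sign of the surplus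
of a row unless a row sum or the total is below half its mean or the fluctuation is exceptionally
large. The event `A` is that the row is a groupie, which agrees with a nonnegative surplus unless
the row is zero. The factor `m / (m + n)` is the proportion of vertices that are rows; without it
the bound fails if `m` is much smaller than `n`. -/
theorem card_div_mul_measureReal_surplus_sign_le [Fintype I] [Fintype J] [Nonempty I] [Nonempty J]
    (h : IsBernoulliMatrix μ p x) (hp₀ : 0 < p) (hp₁ : p ≤ 1) (i : I) {A : Set Ω}
    (hA : ∀ ω, ∑ j, x i j ω ≠ 0 → (ω ∈ A ↔ 0 ≤ surplus (fun i j => x i j ω) i))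
    (hne : Fintype.card I ≠ Fintype.card J) :
    (Fintype.card I : ℝ) / (Fintype.card I + Fintype.card J) *
        μ.real {ω | ¬(ω ∈ A ↔ Fintype.card J < Fintype.card I)} ≤
      2 / (p * √(Fintype.card J)) + 2 / (p * √(Fintype.card J * Fintype.card I)) +
        12 / p ^ 2 * (2 / |(Fintype.card I : ℝ) - Fintype.card J| + 1 / Fintype.card J) := by
  have hn : (1 : ℝ) ≤ Fintype.card J := by exact_mod_cast Fintype.card_pos
  have hm : (1 : ℝ) ≤ Fintype.card I := by exact_mod_cast Fintype.card_pos
  have hdne : (Fintype.card I : ℝ) - Fintype.card J ≠ 0 := sub_ne_zero.2 (by exact_mod_cast hne)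
  have hrow := h.measureReal_row_le hp₀ hp₁ i
  have htot := h.measureReal_total_le hp₀ hp₁
  set noise : Ω → ℝ := fun ω => ∑ j, (x i j ω - p) * ∑ l, (x l j ω - p) -
    (∑ j, (x i j ω - p)) * (∑ j, ∑ l, (x l j ω - p)) / Fintype.card J with hnoise
  have hN : ∫ ω, |noise ω| ∂μ ≤ 3 * (Fintype.card I + Fintype.card J) := by
    have h1 := h.integral_abs_row_dot_columns_le hp₀.le hp₁ i
    have h2 := h.integral_abs_row_mul_total_le hp₀.le hp₁ i
    have h3 : √((Fintype.card J : ℝ) * Fintype.card I) ≤ Fintype.card I + Fintype.card J :=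
      Real.sqrt_le_iff.2 ⟨by positivity, by nlinarith⟩
    have h4 : √(Fintype.card I : ℝ) ≤ Fintype.card I :=
      Real.sqrt_le_iff.2 ⟨by linarith, by nlinarith⟩
    calc _ ≤ ∫ ω, (|∑ j, (x i j ω - p) * ∑ l, (x l j ω - p)| +
          |(∑ j, (x i j ω - p)) * (∑ j, ∑ l, (x l j ω - p)) / Fintype.card J|) ∂μ :=
          integral_mono Integrable.of_finite Integrable.of_finite fun ω => abs_sub _ _
      _ ≤ _ := by
          rw [integral_add Integrable.of_finite Integrable.of_finite]
          linarith
  set m : ℝ := (Fintype.card I : ℝ)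
  set n : ℝ := (Fintype.card J : ℝ)
  have hm₀ : 0 < m := by linarith
  have hn₀ : 0 < n := by linarith
  have hd : 0 < |m - n| := abs_pos.2 hdne
  have ht : 0 < p ^ 2 * n * m * |m - n| / (4 * (m + n)) := by positivity
  have hsub : {ω | ¬(ω ∈ A ↔ Fintype.card J < Fintype.card I)} ⊆
      ({ω | ∑ j, x i j ω ≤ p * n / 2} ∪ {ω | ∑ j, ∑ l, x l j ω ≤ p * (n * m) / 2}) ∪
        {ω | p ^ 2 * n * m * |m - n| / (4 * (m + n)) ≤ |noise ω|} := by
    intro ω hω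
    by_contra hcon
    simp only [Set.mem_union, Set.mem_ofPred_eq, not_or, not_le] at hcon hω
    obtain ⟨⟨c1, c2⟩, c3⟩ := hcon
    have hD : 0 < ∑ j, x i j ω := lt_trans (by positivity) c1
    rw [hA ω hD.ne', surplus_eq _ p] at hω
    change ¬(0 ≤ noise ω + (∑ j, x i j ω) * (∑ j, ∑ l, x l j ω) * (m - n) / ((m + n) * n) ↔ _) at hω
    have hDM : p ^ 2 * n * n * m / 4 ≤ (∑ j, x i j ω) * (∑ j, ∑ l, x l j ω) := by
      have := mul_le_mul c1.le c2.le (by positivity) hD.le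
      calc _ = p * n / 2 * (p * (n * m) / 2) := by ring
        _ ≤ _ := this
    have hdrift : p ^ 2 * n * m * |m - n| / (4 * (m + n)) ≤
        (∑ j, x i j ω) * (∑ j, ∑ l, x l j ω) * |m - n| / ((m + n) * n) := by
      calc _ = p ^ 2 * n * n * m / 4 * |m - n| / ((m + n) * n) := by field_simp
        _ ≤ _ := by gcongr
    have hlt := c3.trans_le hdrift
    rw [abs_lt] at hlt
    apply hω
    rcases lt_or_gt_of_ne hne with hlt' | hlt'
    · have hneg : m - n < 0 := sub_neg.2 (Nat.cast_lt.2 hlt')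
      rw [abs_of_neg hneg] at hlt
      refine iff_of_false ?_ (by omega)
      rw [not_le]
      have := hlt.2
      rw [mul_neg, neg_div] at this
      linarith
    · have hpos : 0 < m - n := sub_pos.2 (Nat.cast_lt.2 hlt')
      rw [abs_of_pos hpos] at hlt
      exact iff_of_true (by linarith [hlt.1]) hlt'
  have hP : μ.real {ω | ¬(ω ∈ A ↔ Fintype.card J < Fintype.card I)} ≤
      2 / (p * √n) + 2 / (p * √(n * m)) +
        3 * (m + n) / (p ^ 2 * n * m * |m - n| / (4 * (m + n))) := by
    calc _ ≤ _ := measureReal_mono hsub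
      _ ≤ _ := measureReal_union_le _ _
      _ ≤ _ := add_le_add (measureReal_union_le _ _) le_rfl
      _ ≤ _ := add_le_add (add_le_add hrow htot) ((measureReal_abs_ge_le ht noise).trans
          (div_le_div_of_nonneg_right hN ht.le))
  have hfrac : m / (m + n) ≤ 1 := (div_le_one (by positivity)).2 (by linarith)
  have hmn : m + n ≤ 2 * n + |m - n| := by linarith [le_abs_self (m - n)]
  calc _ ≤ m / (m + n) * (2 / (p * √n) + 2 / (p * √(n * m)) +
        3 * (m + n) / (p ^ 2 * n * m * |m - n| / (4 * (m + n)))) := by gcongr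
    _ = m / (m + n) * (2 / (p * √n) + 2 / (p * √(n * m))) +
          12 / p ^ 2 * ((m + n) / (n * |m - n|)) := by field_simp; ring
    _ ≤ 1 * (2 / (p * √n) + 2 / (p * √(n * m))) +
          12 / p ^ 2 * ((2 * n + |m - n|) / (n * |m - n|)) := by gcongr
    _ = _ := by field_simp

/-! ### Parts of almost equal sizes -/

/-- Apart from the cross term with the rows other than `i` and `i'`, the surplus of row `i` is
almost deterministic: it consists of the diagonal contribution `n p (1 - p)` and of the drift. -/
theorem integral_abs_surplus_sub_crossTerm_le [DecidableEq I] [Fintype I] [Fintype J] [Nonempty J]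
    (h : IsBernoulliMatrix μ p x) (hp₀ : 0 ≤ p) (hp₁ : p ≤ 1) {i i' : I} (hii : i ≠ i') :
    ∫ ω, |surplus (fun i j => x i j ω) i - crossTerm x p {i, i'}ᶜ i ω -
        (Fintype.card J * (p * (1 - p)) +
          Fintype.card J * p ^ 2 * ((Fintype.card I : ℝ) - Fintype.card J) / 2)| ∂μ ≤
      √(Fintype.card J * 4) + √(Fintype.card I) +
        |(Fintype.card I : ℝ) - Fintype.card J| * (√(Fintype.card J) +
          √(Fintype.card J * Fintype.card I) / (Fintype.card I + Fintype.card J) +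
          |(Fintype.card I : ℝ) - Fintype.card J|) := by
  have : Nonempty I := ⟨i⟩
  have hind : iIndepFun (fun j ω => (x i j ω - p) * ((x i j ω - p) + (x i' j ω - p))) μ :=
    h.indep_columns.comp (fun _ (y : I → ℝ) => (y i - p) * ((y i - p) + (y i' - p)))
      fun _ => by fun_prop
  have h1 : ∀ j, ∫ ω, (x i j ω - p) * ((x i j ω - p) + (x i' j ω - p)) ∂μ = p * (1 - p) :=
    fun j => by
      simp_rw [mul_add]
      rw [integral_add Integrable.of_finite Integrable.of_finite, h.integral_centred_mul hii,
        add_zero]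
      simp_rw [← sq]
      exact h.integral_centred_sq i j
  have h2 : ∀ j, ∫ ω, ((x i j ω - p) * ((x i j ω - p) + (x i' j ω - p))) ^ 2 ∂μ ≤ 4 := fun j => by
    calc _ ≤ ∫ _ω : Ω, (4 : ℝ) ∂μ :=
          integral_mono Integrable.of_finite Integrable.of_finite fun ω => by
            have ha := h.abs_centred_le hp₀ hp₁ i j ω
            have hb := h.abs_centred_le hp₀ hp₁ i' j ω
            have hc : |(x i j ω - p) * ((x i j ω - p) + (x i' j ω - p))| ≤ 2 := by
              rw [abs_mul]
              have := abs_add_le (x i j ω - p) (x i' j ω - p)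
              nlinarith [abs_nonneg (x i j ω - p), abs_nonneg ((x i j ω - p) + (x i' j ω - p))]
            simp only
            nlinarith [abs_le.1 hc]
      _ = 4 := by simp
  have hdiag := integral_abs_sum_sub_le hind h1 h2
  have hprod := h.integral_abs_row_mul_total_le hp₀ hp₁ i
  have hrow := h.integral_abs_row_le hp₀ hp₁ i
  have htot := h.integral_abs_total_le hp₀ hp₁
  have hn : (0 : ℝ) < Fintype.card J := by exact_mod_cast Fintype.card_pos
  have hm : (0 : ℝ) < Fintype.card I := by exact_mod_cast Fintype.card_pos
  have hdec : ∀ ω, surplus (fun i j => x i j ω) i - crossTerm x p {i, i'}ᶜ i ω =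
      ∑ j, (x i j ω - p) * ((x i j ω - p) + (x i' j ω - p)) -
        (∑ j, (x i j ω - p)) * (∑ j, ∑ l, (x l j ω - p)) / Fintype.card J +
      (∑ j, x i j ω) * (∑ j, ∑ l, x l j ω) * ((Fintype.card I : ℝ) - Fintype.card J) /
        ((Fintype.card I + Fintype.card J) * Fintype.card J) := fun ω => by
    have hs : ∀ j, ∑ l, (x l j ω - p) =
        ((x i j ω - p) + (x i' j ω - p)) + ∑ l ∈ {i, i'}ᶜ, (x l j ω - p) := fun j => by
      rw [← Finset.sum_pair hii (f := fun l => x l j ω - p), Finset.sum_add_sum_compl]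
    have : ∑ j, (x i j ω - p) * ∑ l, (x l j ω - p) =
        ∑ j, (x i j ω - p) * ((x i j ω - p) + (x i' j ω - p)) + crossTerm x p {i, i'}ᶜ i ω := by
      simp_rw [hs, crossTerm, ← Finset.sum_add_distrib, mul_add]
    rw [surplus_eq _ p, this]
    ring
  have hDle : ∀ ω, |∑ j, x i j ω| ≤ Fintype.card J := fun ω => by
    refine (Finset.abs_sum_le_sum_abs _ _).trans ?_
    calc _ ≤ ∑ _j : J, (1 : ℝ) := Finset.sum_le_sum fun j _ => by
          rcases h.zero_or_one i j ω with h | h <;> simp [h]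
      _ = _ := by simp
  have hrowe : ∀ ω, ∑ j, (x i j ω - p) = ∑ j, x i j ω - Fintype.card J * p := fun ω => by
    simp [Finset.sum_sub_distrib]
  have htote : ∀ ω, ∑ j, ∑ l, (x l j ω - p) =
      ∑ j, ∑ l, x l j ω - Fintype.card J * (Fintype.card I * p) := fun ω => by
    simp [Finset.sum_sub_distrib]
  set m : ℝ := (Fintype.card I : ℝ)
  set n : ℝ := (Fintype.card J : ℝ)
  have hdrift : ∀ ω, |(∑ j, x i j ω) * (∑ j, ∑ l, x l j ω) * (m - n) / ((m + n) * n) -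
      n * p ^ 2 * (m - n) / 2| ≤ |m - n| * (|∑ j, (x i j ω - p)| +
        |∑ j, ∑ l, (x l j ω - p)| / (m + n) + |m - n|) := fun ω => by
    have e : (∑ j, x i j ω) * (∑ j, ∑ l, x l j ω) * (m - n) / ((m + n) * n) -
        n * p ^ 2 * (m - n) / 2 =
        (m - n) * ((∑ j, (x i j ω - p)) * (p / 2) +
          (∑ j, x i j ω) / n * ((∑ j, ∑ l, (x l j ω - p)) / (m + n)) +
          (∑ j, x i j ω) / n * (n / (m + n)) * (p / 2) * (m - n)) := by
      rw [hrowe, htote]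
      field_simp
      ring
    have hD1 : |(∑ j, x i j ω) / n| ≤ 1 := by
      rw [abs_div, abs_of_pos hn]
      exact (div_le_one hn).2 (hDle ω)
    have hp2 : |p / 2| ≤ 1 := by rw [abs_le]; constructor <;> linarith
    have hnN : |n / (m + n)| ≤ 1 := by
      rw [abs_of_nonneg (by positivity)]
      exact (div_le_one (by positivity)).2 (by linarith)
    rw [e, abs_mul]
    refine mul_le_mul_of_nonneg_left ?_ (abs_nonneg _)
    refine (abs_add_three _ _ _).trans ?_
    refine add_le_add (add_le_add ?_ ?_) ?_
    · rw [abs_mul]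
      exact mul_le_of_le_one_right (abs_nonneg _) hp2
    · rw [abs_mul, abs_div (∑ j, ∑ l, (x l j ω - p)), abs_of_pos (by positivity : 0 < m + n)]
      exact mul_le_of_le_one_left (by positivity) hD1
    · rw [abs_mul, abs_mul, abs_mul]
      refine mul_le_of_le_one_left (abs_nonneg _) ?_
      exact mul_le_one₀ (mul_le_one₀ hD1 (abs_nonneg _) hnN) (abs_nonneg _) hp2
  calc _ ≤ ∫ ω, (|(∑ j, (x i j ω - p) * ((x i j ω - p) + (x i' j ω - p))) - n * (p * (1 - p))| +
          |(∑ j, (x i j ω - p)) * (∑ j, ∑ l, (x l j ω - p)) / n| +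
          |m - n| * (|∑ j, (x i j ω - p)| + |∑ j, ∑ l, (x l j ω - p)| / (m + n) + |m - n|)) ∂μ :=
        integral_mono Integrable.of_finite Integrable.of_finite fun ω => by
          simp only [hdec]
          refine le_trans (le_of_eq ?_) ((abs_add_three _ _ _).trans
            (add_le_add (add_le_add le_rfl (le_of_eq (abs_neg _))) (hdrift ω)))
          congr 1
          ring
    _ ≤ _ := by
        rw [integral_add Integrable.of_finite Integrable.of_finite,
          integral_add Integrable.of_finite Integrable.of_finite, integral_const_mul,
          integral_add Integrable.of_finite Integrable.of_finite,
          integral_add Integrable.of_finite Integrable.of_finite, integral_div]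
        simp only [integral_const, probReal_univ, smul_eq_mul, one_mul]
        gcongr

end IsBernoulliMatrix

namespace IsBernoulliMatrix

variable {Ω : Type*} [MeasurableSpace Ω] {μ : Measure Ω} {I J : Type*} {p : ℝ}
  {x : I → J → Ω → ℝ} [Finite Ω] [MeasurableSingletonClass Ω] [IsProbabilityMeasure μ]

/-- The cross terms of two rows `i ≠ i'` are jointly asymptotically Gaussian and uncorrelated: the
columns are independent, and within a column the entries in the rows `i` and `i'` are independent
of each other and of the other rows. -/
theorem norm_integral_exp_crossTerm_sub_exp_le [DecidableEq I] [Fintype I] [Fintype J]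
    (h : IsBernoulliMatrix μ p x) (hp₀ : 0 ≤ p) (hp₁ : p ≤ 1) {i i' : I} (hii : i ≠ i')
    (a b : ℝ) {K c v : ℝ} (hK : 0 < K) (hc : 0 < c)
    (hv : v = (a ^ 2 + b ^ 2) * (p * (1 - p)) *
      (({i, i'}ᶜ : Finset I).card * (p * (1 - p))) / K ^ 2) :
    ‖∫ ω, Complex.exp (((a * crossTerm x p {i, i'}ᶜ i ω + b * crossTerm x p {i, i'}ᶜ i' ω) / K : ℝ)
          * Complex.I) ∂μ - Complex.exp (-(Fintype.card J * v / 2) : ℝ)‖ ≤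
      Fintype.card J * (2 * (c * v + (|a| + |b|) ^ 4 *
        (3 * (({i, i'}ᶜ : Finset I).card : ℝ) ^ 2) / K ^ 4 / c) + v ^ 2) := by
  set s : Finset I := {i, i'}ᶜ with hs
  set Y : J → Ω → ℝ := fun j ω =>
    (a * (x i j ω - p) + b * (x i' j ω - p)) * (∑ l ∈ s, (x l j ω - p)) / K with hY
  have hind : iIndepFun Y μ :=
    h.indep_columns.comp (fun _ (y : I → ℝ) => (a * (y i - p) + b * (y i' - p)) *
      (∑ l ∈ s, (y l - p)) / K) fun _ => by fun_prop
  have hcol : ∀ j, iIndepFun (fun l ω => x l j ω - p) μ := fun j =>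
    h.indep_centred.precomp (g := fun l => (l, j)) (fun a b hab => by simpa using hab)
  have hsep : ∀ j, IndepFun (fun ω => a * (x i j ω - p) + b * (x i' j ω - p))
      (fun ω => ∑ l ∈ s, (x l j ω - p)) μ := fun j => by
    have h1 := (hcol j).indepFun_finset {i, i'} s (by rw [hs]; exact disjoint_compl_right)
      (fun _ => Measurable.of_discrete)
    have h2 := h1.comp (φ := fun y : ({i, i'} : Finset I) → ℝ =>
      a * y ⟨i, by simp⟩ + b * y ⟨i', by simp⟩) (ψ := fun y : s → ℝ => ∑ l, y l)
      (by fun_prop) (by fun_prop)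
    convert h2 using 1
    · ext ω
      rfl
    · ext ω
      exact (Finset.sum_coe_sort s fun l => x l j ω - p).symm
  have hpow : ∀ j (r : ℕ), ∫ ω, Y j ω ^ r ∂μ =
      (∫ ω, (a * (x i j ω - p) + b * (x i' j ω - p)) ^ r ∂μ) *
        (∫ ω, (∑ l ∈ s, (x l j ω - p)) ^ r ∂μ) / K ^ r := fun j r => by
    simp_rw [hY, div_pow, mul_pow]
    rw [integral_div, (hsep j).integral_fun_comp_mul_comp (f := fun x : ℝ => x ^ r)
      (g := fun x : ℝ => x ^ r) (by fun_prop) (by fun_prop) (by fun_prop) (by fun_prop)]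
  have hT2 : ∀ j, ∫ ω, (∑ l ∈ s, (x l j ω - p)) ^ 2 ∂μ = s.card * (p * (1 - p)) := fun j => by
    have := integral_sq_sum_of_iIndepFun ((hcol j).precomp (g := fun l : s => (l : I))
      Subtype.val_injective) (fun l => h.integral_centred _ j)
    simp only [h.integral_centred_sq, Finset.sum_const, Finset.card_univ, nsmul_eq_mul,
      Fintype.card_coe] at this
    rw [← this]
    refine integral_congr_ae (ae_of_all _ fun ω => ?_)
    simp only
    rw [← Finset.sum_coe_sort s fun l => x l j ω - p]
  have hE2 : ∀ j, ∫ ω, (a * (x i j ω - p) + b * (x i' j ω - p)) ^ 2 ∂μ =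
      (a ^ 2 + b ^ 2) * (p * (1 - p)) := fun j => by
    have e : ∀ ω, (a * (x i j ω - p) + b * (x i' j ω - p)) ^ 2 = a ^ 2 * (x i j ω - p) ^ 2 +
        b ^ 2 * (x i' j ω - p) ^ 2 + 2 * a * b * ((x i j ω - p) * (x i' j ω - p)) := fun ω => by
      ring
    simp_rw [e]
    rw [integral_add Integrable.of_finite Integrable.of_finite,
      integral_add Integrable.of_finite Integrable.of_finite, integral_const_mul,
      integral_const_mul, integral_const_mul, h.integral_centred_sq, h.integral_centred_sq,
      h.integral_centred_mul hii]
    ring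
  have hE4 : ∀ j, ∫ ω, (a * (x i j ω - p) + b * (x i' j ω - p)) ^ 4 ∂μ ≤ (|a| + |b|) ^ 4 :=
    fun j => by
      calc _ ≤ ∫ _ω : Ω, (|a| + |b|) ^ 4 ∂μ :=
            integral_mono Integrable.of_finite Integrable.of_finite fun ω => by
              simp only
              rw [← Even.pow_abs (by decide : Even 4)]
              refine pow_le_pow_left₀ (abs_nonneg _) ((abs_add_le _ _).trans ?_) 4
              rw [abs_mul, abs_mul]
              exact add_le_add
                (mul_le_of_le_one_right (abs_nonneg _) (h.abs_centred_le hp₀ hp₁ i j ω))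
                (mul_le_of_le_one_right (abs_nonneg _) (h.abs_centred_le hp₀ hp₁ i' j ω))
        _ = _ := by simp
  have h0 : ∀ j, ∫ ω, Y j ω ∂μ = 0 := fun j => by
    have := hpow j 1
    simp only [pow_one] at this
    rw [this, (h.column_moments hp₀ hp₁ s j).1]
    simp
  have h2 : ∀ j, ∫ ω, Y j ω ^ 2 ∂μ = v := fun j => by rw [hpow, hE2, hT2, hv]
  have h4 : ∀ j, ∫ ω, Y j ω ^ 4 ∂μ ≤ (|a| + |b|) ^ 4 * (3 * (s.card : ℝ) ^ 2) / K ^ 4 :=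
    fun j => by
      rw [hpow]
      have h1 := (h.column_moments hp₀ hp₁ s j).2.2
      have h2 := hE4 j
      have h3 : 0 ≤ ∫ ω, (∑ l ∈ s, (x l j ω - p)) ^ 4 ∂μ :=
        integral_nonneg fun ω => by positivity
      gcongr
  have hmain := norm_integral_exp_sum_sub_exp_le hind hc h0 h2 h4
  have e : ∀ ω, (a * crossTerm x p s i ω + b * crossTerm x p s i' ω) / K = ∑ j, Y j ω := fun ω => by
    simp_rw [hY, crossTerm, add_mul, add_div, Finset.sum_add_distrib, Finset.mul_sum,
      Finset.sum_div, mul_assoc]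
  simp_rw [e]
  exact hmain

end IsBernoulliMatrix

theorem norm_exp_mul_I_sub_exp_mul_I_le (a b : ℝ) :
    ‖Complex.exp (a * Complex.I) - Complex.exp (b * Complex.I)‖ ≤ |a - b| := by
  have e : Complex.exp (a * Complex.I) - Complex.exp (b * Complex.I) =
      Complex.exp (b * Complex.I) * (Complex.exp (Complex.I * (a - b : ℝ)) - 1) := by
    rw [mul_sub, ← Complex.exp_add, mul_one]
    congr 2
    push_cast
    ring
  rw [e, norm_mul, Complex.norm_exp_ofReal_mul_I, one_mul]
  exact Real.norm_exp_I_mul_ofReal_sub_one_le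

/-! ### Joint asymptotic normality of two surpluses -/

theorem gaussianReal_real_Ici_zero (y : ℝ) :
    (gaussianReal y 1).real (Set.Ici 0) = stdNormalCDF y := by
  have h : (gaussianReal 0 1).map (fun z => y - z) = gaussianReal y 1 := by
    rw [gaussianReal_map_const_sub, sub_zero]
  rw [stdNormalCDF, cdf_eq_real, ← h, map_measureReal_apply (by fun_prop) measurableSet_Ici]
  congr 1
  ext z
  simp

/-- A two-dimensional version of the criterion by characteristic functions: if the characteristic
function of the pair `(U k, V k)` tends to that of two independent normal variables with mean `y`
and variance `1`, then the signs of `U k` and `V k` are asymptotically independent. -/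
theorem tendsto_measureReal_nonneg_of_tendsto_charFun {Ω : ℕ → Type*} [∀ k, MeasurableSpace (Ω k)]
    [∀ k, Finite (Ω k)] [∀ k, MeasurableSingletonClass (Ω k)] {μ : ∀ k, Measure (Ω k)}
    [∀ k, IsProbabilityMeasure (μ k)] {U V : ∀ k, Ω k → ℝ} {y : ℝ}
    (h : ∀ a b : ℝ, Tendsto
      (fun k => ∫ ω, Complex.exp ((a * U k ω + b * V k ω : ℝ) * Complex.I) ∂(μ k)) atTop
      (𝓝 (Complex.exp ((a + b : ℝ) * y * Complex.I - (a ^ 2 + b ^ 2 : ℝ) / 2)))) :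
    Tendsto (fun k => (μ k).real {ω | 0 ≤ U k ω}) atTop (𝓝 (stdNormalCDF y)) ∧
    Tendsto (fun k => (μ k).real {ω | 0 ≤ V k ω}) atTop (𝓝 (stdNormalCDF y)) ∧
    Tendsto (fun k => (μ k).real ({ω | 0 ≤ U k ω} ∩ {ω | 0 ≤ V k ω})) atTop
      (𝓝 (stdNormalCDF y * stdNormalCDF y)) := by
  let E := WithLp 2 (ℝ × ℝ)
  let W : ∀ k, Ω k → E := fun k ω => WithLp.toLp 2 (U k ω, V k ω)
  have hW : ∀ k, Measurable (W k) := fun k => Measurable.of_discrete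
  let ν : ℕ → ProbabilityMeasure E := fun k =>
    ⟨(μ k).map (W k), Measure.isProbabilityMeasure_map (hW k).aemeasurable⟩
  let γ : Measure (ℝ × ℝ) := (gaussianReal y 1).prod (gaussianReal y 1)
  have hto : Measurable (WithLp.toLp 2 : ℝ × ℝ → E) := by fun_prop
  have hof : Measurable (WithLp.ofLp : E → ℝ × ℝ) := by fun_prop
  let ν₀ : ProbabilityMeasure E :=
    ⟨γ.map (WithLp.toLp 2), Measure.isProbabilityMeasure_map hto.aemeasurable⟩
  have hν : Tendsto ν atTop (𝓝 ν₀) := by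
    refine ProbabilityMeasure.tendsto_of_tendsto_charFun fun t => ?_
    have e1 : ∀ k, charFun (ν k : Measure E) t = ∫ ω, Complex.exp
        ((t.ofLp.1 * U k ω + t.ofLp.2 * V k ω : ℝ) * Complex.I) ∂(μ k) := fun k => by
      change charFun ((μ k).map (W k)) t = _
      rw [charFun_apply, integral_map (hW k).aemeasurable (by fun_prop)]
      refine integral_congr_ae (ae_of_all _ fun ω => ?_)
      have e : inner ℝ (W k ω) t = t.ofLp.1 * U k ω + t.ofLp.2 * V k ω := by
        rw [WithLp.prod_inner_apply]
        simp [W]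
      simp only [e]
    have e2 : charFun (ν₀ : Measure E) t = Complex.exp
        ((t.ofLp.1 + t.ofLp.2 : ℝ) * y * Complex.I - (t.ofLp.1 ^ 2 + t.ofLp.2 ^ 2 : ℝ) / 2) := by
      change charFun (γ.map (WithLp.toLp 2)) t = _
      rw [charFun_prod, charFun_gaussianReal, charFun_gaussianReal, ← Complex.exp_add]
      congr 1
      push_cast
      ring
    simp_rw [e1, e2]
    exact h _ _
  have hset : ∀ A B : Set ℝ, MeasurableSet A → MeasurableSet B →
      gaussianReal y 1 (frontier A) = 0 → gaussianReal y 1 (frontier B) = 0 →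
      Tendsto (fun k => (μ k).real (U k ⁻¹' A ∩ V k ⁻¹' B)) atTop
        (𝓝 ((gaussianReal y 1).real A * (gaussianReal y 1).real B)) := by
    intro A B hA hB hfA hfB
    have hfr : (ν₀ : Measure E) (frontier (WithLp.ofLp ⁻¹' (A ×ˢ B))) = 0 := by
      have hsub : frontier ((WithLp.ofLp : E → ℝ × ℝ) ⁻¹' (A ×ˢ B)) ⊆
          WithLp.ofLp ⁻¹' (frontier (A ×ˢ B)) :=
        (WithLp.prod_continuous_ofLp 2 ℝ ℝ).frontier_preimage_subset _
      refine measure_mono_null hsub ?_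
      change γ.map (WithLp.toLp 2) _ = 0
      rw [Measure.map_apply hto (hof isClosed_frontier.measurableSet)]
      change γ (frontier (A ×ˢ B)) = 0
      rw [frontier_prod_eq]
      refine measure_union_null ?_ ?_
      · rw [Measure.prod_prod, hfB, mul_zero]
      · rw [Measure.prod_prod, hfA, zero_mul]
    have := ProbabilityMeasure.tendsto_measure_of_null_frontier_of_tendsto' hν hfr
    have h2 := (ENNReal.tendsto_toReal (measure_ne_top _ _)).comp this
    have e1 : ((ν₀ : Measure E) (WithLp.ofLp ⁻¹' (A ×ˢ B))).toReal =
        (gaussianReal y 1).real A * (gaussianReal y 1).real B := by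
      change (γ.map (WithLp.toLp 2) _).toReal = _
      rw [Measure.map_apply hto (hof (hA.prod hB))]
      change (γ (A ×ˢ B)).toReal = _
      rw [Measure.prod_prod, ENNReal.toReal_mul]
      rfl
    rw [e1] at h2
    refine h2.congr fun k => ?_
    change ((μ k).map (W k) _).toReal = _
    rw [Measure.map_apply (hW k) (hof (hA.prod hB))]
    rfl
  have : NullSingletonClass (gaussianReal y 1) :=
    nullSingletonClass_gaussianReal one_ne_zero
  have hI : gaussianReal y 1 (frontier (Set.Ici 0)) = 0 := by
    rw [frontier_Ici]
    exact measure_singleton _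
  have hU : gaussianReal y 1 (frontier Set.univ) = 0 := by simp
  rw [← gaussianReal_real_Ici_zero y]
  refine ⟨?_, ?_, hset _ _ measurableSet_Ici measurableSet_Ici hI hI⟩
  · have := hset _ _ measurableSet_Ici MeasurableSet.univ hI hU
    rw [probReal_univ, mul_one] at this
    exact this.congr fun k => by rw [Set.preimage_univ, Set.inter_univ]; rfl
  · have := hset _ _ MeasurableSet.univ measurableSet_Ici hU hI
    rw [probReal_univ, one_mul] at this
    exact this.congr fun k => by rw [Set.preimage_univ, Set.univ_inter]; rfl

section Sequences

variable {Ω : ℕ → Type*} [∀ k, MeasurableSpace (Ω k)]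
  [∀ k, Finite (Ω k)] [∀ k, MeasurableSingletonClass (Ω k)] {μ : ∀ k, Measure (Ω k)}
  [∀ k, IsProbabilityMeasure (μ k)] {I J : ℕ → Type*} [∀ k, Fintype (I k)] [∀ k, Fintype (J k)]
  [∀ k, Nonempty (J k)] {p : ℝ} {x : ∀ k, I k → J k → Ω k → ℝ} {δ : ℝ}

/-- After division by `n p (1 - p)`, the cross terms of two rows are asymptotically independent
standard normal variables. The rows may depend on `k`. -/
theorem tendsto_charFun_crossTerm [∀ k, DecidableEq (I k)]
    (h : ∀ k, IsBernoulliMatrix (μ k) p (x k)) (hp₀ : 0 < p) (hp₁ : p < 1)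
    (hn : Tendsto (fun k => (Fintype.card (J k) : ℝ)) atTop atTop)
    (hδ : ∀ k, (Fintype.card (I k) : ℝ) - Fintype.card (J k) = δ) {i i' : ∀ k, I k}
    (hii : ∀ k, i k ≠ i' k) (a b : ℝ) :
    Tendsto (fun k => ∫ ω, Complex.exp (((a * crossTerm (x k) p {i k, i' k}ᶜ (i k) ω +
      b * crossTerm (x k) p {i k, i' k}ᶜ (i' k) ω) / (Fintype.card (J k) * (p * (1 - p))) : ℝ)
        * Complex.I) ∂(μ k)) atTop (𝓝 (Complex.exp (-((a ^ 2 + b ^ 2) / 2) : ℝ))) := by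
  set n : ℕ → ℝ := fun k => (Fintype.card (J k) : ℝ) with hndef
  have hq : 0 < p * (1 - p) := mul_pos hp₀ (by linarith)
  have hn₀ : ∀ k, 0 < n k := fun k => by
    simp only [hndef]
    exact_mod_cast Fintype.card_pos
  set s : ∀ k, Finset (I k) := fun k => {i k, i' k}ᶜ with hs
  have hcard : ∀ k, ((s k).card : ℝ) = n k + (δ - 2) := fun k => by
    have h1 := Finset.card_compl_add_card ({i k, i' k} : Finset (I k))
    rw [Finset.card_pair (hii k)] at h1
    have h2 : (((s k).card + 2 : ℕ) : ℝ) = Fintype.card (I k) := by exact_mod_cast h1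
    push_cast at h2
    have := hδ k
    simp only [hndef]
    linarith
  have hinv : Tendsto (fun k => (n k)⁻¹) atTop (𝓝 0) := tendsto_inv_atTop_zero.comp hn
  have hsqrt : Tendsto (fun k => (√(n k))⁻¹) atTop (𝓝 0) :=
    tendsto_inv_atTop_zero.comp (Real.tendsto_sqrt_atTop.comp hn)
  have hr : Tendsto (fun k => ((s k).card : ℝ) / n k) atTop (𝓝 1) := by
    have : Tendsto (fun k => 1 + (δ - 2) * (n k)⁻¹) atTop (𝓝 (1 + (δ - 2) * 0)) :=
      tendsto_const_nhds.add (tendsto_const_nhds.mul hinv)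
    simp only [mul_zero, add_zero] at this
    refine this.congr fun k => ?_
    have := hn₀ k
    rw [hcard]
    field_simp
  set v : ℕ → ℝ := fun k => (a ^ 2 + b ^ 2) * (p * (1 - p)) *
      ((s k).card * (p * (1 - p))) / (n k * (p * (1 - p))) ^ 2 with hv
  have hnv : ∀ k, n k * v k = (a ^ 2 + b ^ 2) * ((s k).card / n k) := fun k => by
    have := hn₀ k
    have hp1 : 0 < 1 - p := by linarith
    simp only [hv]
    field_simp
  have hnv' : Tendsto (fun k => n k * v k) atTop (𝓝 (a ^ 2 + b ^ 2)) := by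
    simp_rw [hnv]
    simpa using (tendsto_const_nhds (x := a ^ 2 + b ^ 2)).mul hr
  -- the parameter `c = 1 / √n` makes all error terms of order at most `1 / √n`
  have hbound := fun k => (h k).norm_integral_exp_crossTerm_sub_exp_le hp₀.le hp₁.le (hii k) a b
    (K := n k * (p * (1 - p))) (c := (√(n k))⁻¹) (v := v k) (mul_pos (hn₀ k) hq)
    (inv_pos.2 (Real.sqrt_pos.2 (hn₀ k))) rfl
  have herr : Tendsto (fun k => n k * (2 * ((√(n k))⁻¹ * v k + (|a| + |b|) ^ 4 *
      (3 * ((s k).card : ℝ) ^ 2) / (n k * (p * (1 - p))) ^ 4 / (√(n k))⁻¹) + v k ^ 2))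
      atTop (𝓝 0) := by
    have hlim : Tendsto (fun k => 2 * ((√(n k))⁻¹ * (n k * v k) + (|a| + |b|) ^ 4 * 3 /
        (p * (1 - p)) ^ 4 * ((s k).card / n k) ^ 2 * (√(n k))⁻¹) + (n k * v k) ^ 2 * (n k)⁻¹)
        atTop (𝓝 (2 * (0 * (a ^ 2 + b ^ 2) + (|a| + |b|) ^ 4 * 3 / (p * (1 - p)) ^ 4 *
          1 ^ 2 * 0) + (a ^ 2 + b ^ 2) ^ 2 * 0)) :=
      (((hsqrt.mul hnv').add ((tendsto_const_nhds.mul (hr.pow 2)).mul hsqrt)).const_mul 2).add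
        ((hnv'.pow 2).mul hinv)
    simp only [zero_mul, mul_zero, add_zero] at hlim
    refine hlim.congr fun k => ?_
    have h1 := hn₀ k
    have h2 := Real.sqrt_pos.2 h1
    have h3 : n k = √(n k) ^ 2 := (Real.sq_sqrt h1.le).symm
    set r := √(n k)
    rw [h3]
    have hp1 : 0 < 1 - p := by linarith
    field_simp
  have hz : Tendsto (fun k => ∫ ω, Complex.exp (((a * crossTerm (x k) p (s k) (i k) ω +
      b * crossTerm (x k) p (s k) (i' k) ω) / (n k * (p * (1 - p))) : ℝ) * Complex.I) ∂(μ k) -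
      Complex.exp (-(n k * v k / 2) : ℝ)) atTop (𝓝 0) :=
    squeeze_zero_norm hbound herr
  have hexp : Tendsto (fun k => Complex.exp (-(n k * v k / 2) : ℝ)) atTop
      (𝓝 (Complex.exp (-((a ^ 2 + b ^ 2) / 2) : ℝ))) :=
    (Complex.continuous_exp.tendsto _).comp
      ((Complex.continuous_ofReal.tendsto _).comp (hnv'.div_const 2).neg)
  have := hz.add hexp
  rw [zero_add] at this
  exact this.congr fun k => sub_add_cancel _ _

/-- The normalized surpluses of two rows are asymptotically independent normal variables of
variance `1`. Their mean is `1`, from the diagonal contribution, plus the drift caused by the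
difference `δ` of the numbers of rows and columns. -/
theorem tendsto_charFun_surplus (h : ∀ k, IsBernoulliMatrix (μ k) p (x k)) (hp₀ : 0 < p)
    (hp₁ : p < 1) (hn : Tendsto (fun k => (Fintype.card (J k) : ℝ)) atTop atTop)
    (hδ : ∀ k, (Fintype.card (I k) : ℝ) - Fintype.card (J k) = δ) {i i' : ∀ k, I k}
    (hii : ∀ k, i k ≠ i' k) (a b : ℝ) :
    Tendsto (fun k => ∫ ω, Complex.exp
      ((a * (surplus (fun i j => x k i j ω) (i k) / (Fintype.card (J k) * (p * (1 - p)))) +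
        b * (surplus (fun i j => x k i j ω) (i' k) / (Fintype.card (J k) * (p * (1 - p)))) : ℝ)
        * Complex.I) ∂(μ k)) atTop
      (𝓝 (Complex.exp ((a + b : ℝ) * (1 + p * δ / (2 * (1 - p)) : ℝ) * Complex.I -
        (a ^ 2 + b ^ 2 : ℝ) / 2))) := by
  classical
  set n : ℕ → ℝ := fun k => (Fintype.card (J k) : ℝ) with hndef
  have hp1 : 0 < 1 - p := by linarith
  have hq : 0 < p * (1 - p) := mul_pos hp₀ hp1
  have hn₀ : ∀ k, 0 < n k := fun k => by
    simp only [hndef]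
    exact_mod_cast Fintype.card_pos
  set y : ℝ := 1 + p * δ / (2 * (1 - p)) with hy
  set F : ∀ k, I k → Ω k → ℝ := fun k l ω => surplus (fun i j => x k i j ω) l
  set C : ∀ k, I k → Ω k → ℝ := fun k => crossTerm (x k) p {i k, i' k}ᶜ with hC
  set R : ∀ k, I k → Ω k → ℝ := fun k l ω =>
    (F k l ω - C k l ω) / (n k * (p * (1 - p))) - y with hR
  set ρ : ℕ → ℝ := fun k => ((3 + |δ|) * (√(n k))⁻¹ + (√|δ| + |δ| + |δ| * |δ|) * (n k)⁻¹) /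
    (p * (1 - p)) with hρ
  have hinv : Tendsto (fun k => (n k)⁻¹) atTop (𝓝 0) := tendsto_inv_atTop_zero.comp hn
  have hsqrt : Tendsto (fun k => (√(n k))⁻¹) atTop (𝓝 0) :=
    tendsto_inv_atTop_zero.comp (Real.tendsto_sqrt_atTop.comp hn)
  have hρ0 : Tendsto ρ atTop (𝓝 0) := by
    have := ((hsqrt.const_mul (3 + |δ|)).add
      (hinv.const_mul (√|δ| + |δ| + |δ| * |δ|))).div_const (p * (1 - p))
    simpa only [mul_zero, add_zero, zero_div] using this
  have hRint : ∀ k, ∀ l l' : I k, l ≠ l' → C k = crossTerm (x k) p {l, l'}ᶜ →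
      ∫ ω, |R k l ω| ∂(μ k) ≤ ρ k := fun k l l' hll hCl => by
    have h1 := (h k).integral_abs_surplus_sub_crossTerm_le hp₀.le hp₁.le hll
    rw [← hCl, hδ k] at h1
    have hpos := mul_pos (hn₀ k) hq
    have e : ∀ ω, |R k l ω| = |F k l ω - C k l ω -
        (n k * (p * (1 - p)) + n k * p ^ 2 * δ / 2)| / (n k * (p * (1 - p))) := fun ω => by
      have h2 := hn₀ k
      rw [← abs_of_pos hpos, ← abs_div, abs_of_pos hpos]
      congr 1
      simp only [hR, hy]
      field_simp
    simp_rw [e]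
    rw [integral_div, div_le_iff₀ hpos]
    refine h1.trans ?_
    have hm : (Fintype.card (I k) : ℝ) = n k + δ := by
      have := hδ k
      simp only [hndef]
      linarith
    have hm₀ : (0 : ℝ) ≤ Fintype.card (I k) := Nat.cast_nonneg _
    have h3 := hn₀ k
    have s1 : √(n k * 4) = 2 * √(n k) := by
      rw [Real.sqrt_mul h3.le, show (4 : ℝ) = 2 ^ 2 by norm_num, Real.sqrt_sq (by norm_num)]
      ring
    have s2 : √(Fintype.card (I k) : ℝ) ≤ √(n k) + √|δ| := by
      rw [hm]
      refine (Real.sqrt_le_sqrt (by linarith [le_abs_self δ] : n k + δ ≤ n k + |δ|)).trans ?_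
      refine Real.sqrt_le_iff.2 ⟨by positivity, ?_⟩
      have h4 := Real.sq_sqrt h3.le
      have h5 := Real.sq_sqrt (abs_nonneg δ)
      have h6 : 0 ≤ √(n k) * √|δ| := by positivity
      nlinarith
    have s3 : √(n k * Fintype.card (I k)) / (Fintype.card (I k) + n k) ≤ 1 := by
      rw [div_le_one (by linarith)]
      exact Real.sqrt_le_iff.2 ⟨by linarith, by nlinarith⟩
    have e2 : ρ k * (n k * (p * (1 - p))) = (3 + |δ|) * √(n k) + (√|δ| + |δ| + |δ| * |δ|) := by
      have h4 := Real.sqrt_pos.2 h3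
      have h5 : n k = √(n k) ^ 2 := (Real.sq_sqrt h3.le).symm
      simp only [hρ]
      set r := √(n k)
      rw [h5]
      field_simp
    rw [e2]
    change √(n k * 4) + √(Fintype.card (I k) : ℝ) + |δ| * (√(n k) +
      √(n k * Fintype.card (I k)) / (Fintype.card (I k) + n k) + |δ|) ≤ _
    rw [s1]
    nlinarith [mul_le_mul_of_nonneg_left s3 (abs_nonneg δ)]
  have hclt := (tendsto_charFun_crossTerm h hp₀ hp₁ hn hδ hii a b).mul_const
    (Complex.exp ((a + b : ℝ) * y * Complex.I))
  have hlimit : Complex.exp (-((a ^ 2 + b ^ 2) / 2) : ℝ) *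
      Complex.exp ((a + b : ℝ) * y * Complex.I) =
      Complex.exp ((a + b : ℝ) * y * Complex.I - (a ^ 2 + b ^ 2 : ℝ) / 2) := by
    rw [← Complex.exp_add]
    congr 1
    push_cast
    ring
  rw [hlimit] at hclt
  have hdiff : Tendsto (fun k =>
      ∫ ω, Complex.exp ((a * (F k (i k) ω / (n k * (p * (1 - p)))) +
        b * (F k (i' k) ω / (n k * (p * (1 - p)))) : ℝ) * Complex.I) ∂(μ k) -
      (∫ ω, Complex.exp (((a * C k (i k) ω + b * C k (i' k) ω) / (n k * (p * (1 - p))) : ℝ)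
        * Complex.I) ∂(μ k)) * Complex.exp ((a + b : ℝ) * y * Complex.I)) atTop (𝓝 0) := by
    refine squeeze_zero_norm (a := fun k => |a| * ρ k + |b| * ρ k) (fun k => ?_) ?_
    · rw [← integral_mul_const, ← integral_sub Integrable.of_finite Integrable.of_finite]
      refine (norm_integral_le_integral_norm _).trans ?_
      calc _ ≤ ∫ ω, (|a| * |R k (i k) ω| + |b| * |R k (i' k) ω|) ∂(μ k) :=
            integral_mono Integrable.of_finite Integrable.of_finite fun ω => by
              simp only
              rw [← Complex.exp_add]
              have e : (((a * C k (i k) ω + b * C k (i' k) ω) / (n k * (p * (1 - p))) : ℝ) : ℂ) *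
                  Complex.I + (a + b : ℝ) * y * Complex.I =
                  ((a * C k (i k) ω + b * C k (i' k) ω) / (n k * (p * (1 - p))) +
                    (a + b) * y : ℝ) * Complex.I := by
                push_cast
                ring
              rw [e]
              refine (norm_exp_mul_I_sub_exp_mul_I_le _ _).trans ?_
              rw [← abs_mul, ← abs_mul]
              refine le_trans (le_of_eq ?_) (abs_add_le _ _)
              congr 1
              simp only [hR]
              ring
        _ = |a| * ∫ ω, |R k (i k) ω| ∂(μ k) + |b| * ∫ ω, |R k (i' k) ω| ∂(μ k) := by
            rw [integral_add Integrable.of_finite Integrable.of_finite, integral_const_mul,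
              integral_const_mul]
        _ ≤ _ := by
            have r1 := hRint k (i k) (i' k) (hii k) rfl
            have r2 := hRint k (i' k) (i k) (hii k).symm (by
              simp only [hC]
              rw [Finset.pair_comm])
            gcongr
    · simpa using (hρ0.const_mul |a|).add (hρ0.const_mul |b|)
  have := hdiff.add hclt
  rw [zero_add] at this
  exact this.congr fun k => sub_add_cancel _ _

end Sequences

/-! ### Counting almost uncorrelated events -/

section Events

variable {Ω : Type*} [MeasurableSpace Ω] {μ : Measure Ω} [IsProbabilityMeasure μ]

theorem abs_measureReal_sub_le {A S Z : Set Ω} (h : ∀ ω, ω ∉ Z → (ω ∈ A ↔ ω ∈ S)) :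
    |μ.real A - μ.real S| ≤ μ.real Z := by
  have h1 : μ.real A ≤ μ.real S + μ.real Z :=
    (measureReal_mono (s₂ := S ∪ Z) fun ω hω => by
      by_cases hz : ω ∈ Z
      · exact Or.inr hz
      · exact Or.inl ((h ω hz).1 hω)).trans (measureReal_union_le _ _)
  have h2 : μ.real S ≤ μ.real A + μ.real Z :=
    (measureReal_mono (s₂ := A ∪ Z) fun ω hω => by
      by_cases hz : ω ∈ Z
      · exact Or.inr hz
      · exact Or.inl ((h ω hz).2 hω)).trans (measureReal_union_le _ _)
  rw [abs_le]
  constructor <;> linarith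

variable [Finite Ω] [MeasurableSingletonClass Ω]

theorem integral_indicator_sub_mul_indicator_sub (A B : Set Ω) (L : ℝ) :
    ∫ ω, (A.indicator 1 ω - L) * (B.indicator 1 ω - L) ∂μ =
      μ.real (A ∩ B) - L * μ.real A - L * μ.real B + L ^ 2 := by
  have hi : ∀ S : Set Ω, ∫ ω, S.indicator (1 : Ω → ℝ) ω ∂μ = μ.real S := fun S =>
    integral_indicator_one S.toFinite.measurableSet
  have e : ∀ ω, ((A.indicator 1 ω : ℝ) - L) * (B.indicator 1 ω - L) =
      (A ∩ B).indicator 1 ω - L * A.indicator 1 ω - L * B.indicator 1 ω + L ^ 2 := fun ω => by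
    rw [Set.inter_indicator_one, Pi.mul_apply]
    ring
  simp_rw [e]
  rw [integral_add Integrable.of_finite Integrable.of_finite,
    integral_sub Integrable.of_finite Integrable.of_finite,
    integral_sub Integrable.of_finite Integrable.of_finite, integral_const_mul, integral_const_mul,
    hi, hi, hi]
  simp

/-- The second moment method: the number of events `A i` that occur is close to `L` times the
number of indices if different events are almost uncorrelated and of probability almost `L`. -/
theorem integral_abs_sum_indicator_sub_le {ι : Type*} [Fintype ι] {A : ι → Set Ω} {L η : ℝ}
    (hL₀ : 0 ≤ L) (hL₁ : L ≤ 1) (hη : 0 ≤ η)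
    (h : ∀ i i', i ≠ i' →
      |∫ ω, ((A i).indicator 1 ω - L) * ((A i').indicator 1 ω - L) ∂μ| ≤ η) :
    ∫ ω, |∑ i, ((A i).indicator 1 ω - L)| ∂μ ≤
      √(Fintype.card ι + (Fintype.card ι : ℝ) ^ 2 * η) := by
  classical
  refine (integral_abs_le_sqrt _).trans (Real.sqrt_le_sqrt ?_)
  have e : ∀ ω, (∑ i, ((A i).indicator 1 ω - L)) ^ 2 =
      ∑ i, ∑ i', ((A i).indicator 1 ω - L) * ((A i').indicator 1 ω - L) := fun ω => by
    rw [sq, Finset.sum_mul_sum]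
  simp_rw [e]
  rw [integral_finsetSum _ fun _ _ => Integrable.of_finite]
  simp_rw [integral_finsetSum Finset.univ fun _ _ => Integrable.of_finite]
  have hdiag : ∀ i, ∫ ω, ((A i).indicator 1 ω - L) * ((A i).indicator 1 ω - L) ∂μ ≤ 1 := fun i => by
    calc _ ≤ ∫ _ω : Ω, (1 : ℝ) ∂μ :=
          integral_mono Integrable.of_finite Integrable.of_finite fun ω => by
            by_cases hω : ω ∈ A i <;> simp [hω] <;> nlinarith
      _ = 1 := by simp
  calc _ ≤ ∑ i : ι, ∑ i' : ι, ((if i = i' then 1 else 0) + η) :=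
        Finset.sum_le_sum fun i _ => Finset.sum_le_sum fun i' _ => by
          by_cases hii : i = i'
          · subst hii
            simpa using (hdiag i).trans (by linarith)
          · simpa [hii] using (le_abs_self _).trans (h i i' hii)
    _ = _ := by
        simp [Finset.sum_add_distrib]
        ring

end Events

/-- When the parts have different sizes, almost all vertices of the larger part and almost none of
the smaller part are groupies. -/
theorem IsBernoulliMatrix.integral_abs_sum_indicator_sub_ite_div_le {Ω : Type*} [MeasurableSpace Ω]
    [Finite Ω] [MeasurableSingletonClass Ω] {μ : Measure Ω} [IsProbabilityMeasure μ] {I J : Type*}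
    {p : ℝ} {x : I → J → Ω → ℝ} [Fintype I] [Fintype J] [Nonempty I] [Nonempty J]
    (h : IsBernoulliMatrix μ p x) (hp₀ : 0 < p) (hp₁ : p ≤ 1) {A : I → Set Ω}
    (hA : ∀ i ω, ∑ j, x i j ω ≠ 0 → (ω ∈ A i ↔ 0 ≤ surplus (fun i j => x i j ω) i))
    (hne : Fintype.card I ≠ Fintype.card J) :
    (∫ ω, |∑ i, ((A i).indicator 1 ω -
        if Fintype.card J < Fintype.card I then (1 : ℝ) else 0)| ∂μ) /
        (Fintype.card I + Fintype.card J) ≤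
      2 / (p * √(Fintype.card J)) + 2 / (p * √(Fintype.card J * Fintype.card I)) +
        12 / p ^ 2 * (2 / |(Fintype.card I : ℝ) - Fintype.card J| + 1 / Fintype.card J) := by
  have hn : (0 : ℝ) < Fintype.card J := by exact_mod_cast Fintype.card_pos
  have hm : (0 : ℝ) < Fintype.card I := by exact_mod_cast Fintype.card_pos
  set L : ℝ := if Fintype.card J < Fintype.card I then (1 : ℝ) else 0 with hL
  set B : ℝ := 2 / (p * √(Fintype.card J)) + 2 / (p * √(Fintype.card J * Fintype.card I)) +
        12 / p ^ 2 * (2 / |(Fintype.card I : ℝ) - Fintype.card J| + 1 / Fintype.card J)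
  have hone : ∀ i, ∫ ω, |(A i).indicator 1 ω - L| ∂μ =
      μ.real {ω | ¬(ω ∈ A i ↔ Fintype.card J < Fintype.card I)} := fun i => by
    rw [← integral_indicator_one (Set.toFinite _).measurableSet]
    refine integral_congr_ae (ae_of_all _ fun ω => ?_)
    simp only [hL]
    by_cases h1 : ω ∈ A i <;> by_cases h2 : Fintype.card J < Fintype.card I <;>
      simp [Set.indicator, h1, h2]
  calc _ ≤ (∑ i, ∫ ω, |(A i).indicator 1 ω - L| ∂μ) / (Fintype.card I + Fintype.card J) := by
        rw [← integral_finsetSum _ fun _ _ => Integrable.of_finite]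
        refine div_le_div_of_nonneg_right ?_ (by positivity)
        exact integral_mono Integrable.of_finite Integrable.of_finite fun ω =>
          Finset.abs_sum_le_sum_abs _ _
    _ = ∑ i : I, (Fintype.card I : ℝ)⁻¹ *
          ((Fintype.card I : ℝ) / (Fintype.card I + Fintype.card J) *
            μ.real {ω | ¬(ω ∈ A i ↔ Fintype.card J < Fintype.card I)}) := by
        rw [Finset.sum_div]
        refine Finset.sum_congr rfl fun i _ => ?_
        rw [hone]
        field_simp
    _ ≤ ∑ _i : I, (Fintype.card I : ℝ)⁻¹ * B :=
        Finset.sum_le_sum fun i _ => mul_le_mul_of_nonneg_left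
          (h.card_div_mul_measureReal_surplus_sign_le hp₀ hp₁ i (hA i) hne) (by positivity)
    _ = B := by
        rw [Finset.sum_const, nsmul_eq_mul, Finset.card_univ, ← mul_assoc, mul_inv_cancel₀ hm.ne',
          one_mul]

section Sequences

variable {Ω : ℕ → Type*} [∀ k, MeasurableSpace (Ω k)]
  [∀ k, Finite (Ω k)] [∀ k, MeasurableSingletonClass (Ω k)] {μ : ∀ k, Measure (Ω k)}
  [∀ k, IsProbabilityMeasure (μ k)] {I J : ℕ → Type*} [∀ k, Fintype (I k)] [∀ k, Fintype (J k)]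
  [∀ k, Nonempty (J k)] {p : ℝ} {x : ∀ k, I k → J k → Ω k → ℝ} {δ : ℝ}

/-- For two different rows, the events of being a groupie are asymptotically uncorrelated and have
the same limiting probability. -/
theorem tendsto_integral_indicator_sub_mul_indicator_sub
    (h : ∀ k, IsBernoulliMatrix (μ k) p (x k)) (hp₀ : 0 < p) (hp₁ : p < 1)
    (hn : Tendsto (fun k => (Fintype.card (J k) : ℝ)) atTop atTop)
    (hδ : ∀ k, (Fintype.card (I k) : ℝ) - Fintype.card (J k) = δ) {A : ∀ k, I k → Set (Ω k)}
    (hA : ∀ k i ω, ∑ j, x k i j ω ≠ 0 → (ω ∈ A k i ↔ 0 ≤ surplus (fun i j => x k i j ω) i))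
    {i i' : ∀ k, I k} (hii : ∀ k, i k ≠ i' k) :
    Tendsto (fun k => ∫ ω, ((A k (i k)).indicator 1 ω - stdNormalCDF (1 + p * δ / (2 * (1 - p)))) *
      ((A k (i' k)).indicator 1 ω - stdNormalCDF (1 + p * δ / (2 * (1 - p)))) ∂(μ k)) atTop
      (𝓝 0) := by
  obtain ⟨t1, t2, t3⟩ := tendsto_measureReal_nonneg_of_tendsto_charFun
    (tendsto_charFun_surplus h hp₀ hp₁ hn hδ hii)
  set L := stdNormalCDF (1 + p * δ / (2 * (1 - p)))
  have hpos : ∀ k, 0 < (Fintype.card (J k) : ℝ) * (p * (1 - p)) := fun k =>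
    mul_pos (by exact_mod_cast Fintype.card_pos) (mul_pos hp₀ (by linarith))
  have hU : ∀ k (l : I k) (ω : Ω k), 0 ≤ surplus (fun i j => x k i j ω) l /
      (Fintype.card (J k) * (p * (1 - p))) ↔ 0 ≤ surplus (fun i j => x k i j ω) l := fun k l ω => by
    rw [le_div_iff₀ (hpos k), zero_mul]
  simp_rw [hU] at t1 t2 t3
  set S : ∀ k, I k → Set (Ω k) := fun k l => {ω | 0 ≤ surplus (fun i j => x k i j ω) l}
  -- the rows without ones, where `A` is not determined by the surplus
  set Z : ∀ k, I k → Set (Ω k) := fun k l => {ω | ∑ j, x k l j ω = 0}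
  have hZ : ∀ k l, (μ k).real (Z k l) ≤ 2 / p * (√(Fintype.card (J k) : ℝ))⁻¹ := fun k l => by
    refine (measureReal_mono ?_).trans (((h k).measureReal_row_le hp₀ hp₁.le l).trans_eq ?_)
    · intro ω hω
      have h1 : ∑ j, x k l j ω = 0 := hω
      rw [Set.mem_ofPred_eq, h1]
      positivity
    · field_simp
  have hb : Tendsto (fun k => 2 / p * (√(Fintype.card (J k) : ℝ))⁻¹) atTop (𝓝 0) := by
    simpa using (tendsto_inv_atTop_zero.comp (Real.tendsto_sqrt_atTop.comp hn)).const_mul (2 / p)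
  have hsingle : ∀ l : ∀ k, I k, Tendsto (fun k => (μ k).real (S k (l k))) atTop (𝓝 L) →
      Tendsto (fun k => (μ k).real (A k (l k))) atTop (𝓝 L) := fun l hl => by
    have h1 : Tendsto (fun k => (μ k).real (A k (l k)) - (μ k).real (S k (l k))) atTop (𝓝 0) :=
      squeeze_zero_norm (fun k => (abs_measureReal_sub_le
        (fun ω hω => hA k (l k) ω hω)).trans (hZ k (l k))) hb
    simpa using h1.add hl
  have hpair : Tendsto (fun k => (μ k).real (A k (i k) ∩ A k (i' k))) atTop (𝓝 (L * L)) := by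
    have h1 : Tendsto (fun k => (μ k).real (A k (i k) ∩ A k (i' k)) -
        (μ k).real (S k (i k) ∩ S k (i' k))) atTop (𝓝 0) := by
      refine squeeze_zero_norm (a := fun k => 2 / p * (√(Fintype.card (J k) : ℝ))⁻¹ +
        2 / p * (√(Fintype.card (J k) : ℝ))⁻¹) (fun k => ?_) (by simpa using hb.add hb)
      refine (abs_measureReal_sub_le (Z := Z k (i k) ∪ Z k (i' k)) fun ω hω => ?_).trans
        ((measureReal_union_le _ _).trans (add_le_add (hZ k _) (hZ k _)))
      rw [Set.mem_union, not_or] at hω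
      exact and_congr (hA k (i k) ω hω.1) (hA k (i' k) ω hω.2)
    have h2 := h1.add t3
    rw [zero_add] at h2
    exact h2.congr fun k => sub_add_cancel _ _
  simp_rw [integral_indicator_sub_mul_indicator_sub]
  have := ((hpair.sub ((hsingle i t1).const_mul L)).sub
    ((hsingle i' t2).const_mul L)).add_const (L ^ 2)
  convert this using 2
  ring

theorem stdNormalCDF_nonneg (y : ℝ) : 0 ≤ stdNormalCDF y := cdf_nonneg _ _

theorem stdNormalCDF_le_one (y : ℝ) : stdNormalCDF y ≤ 1 := cdf_le_one _ _

/-- When the numbers of rows and columns differ by a constant `δ`, the proportion of groupies among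
the rows concentrates at the limiting probability that a single row is a groupie. -/
theorem tendsto_integral_abs_sum_indicator_sub_div [∀ k, Nontrivial (I k)]
    (h : ∀ k, IsBernoulliMatrix (μ k) p (x k)) (hp₀ : 0 < p) (hp₁ : p < 1)
    (hm : Tendsto (fun k => (Fintype.card (I k) : ℝ)) atTop atTop)
    (hn : Tendsto (fun k => (Fintype.card (J k) : ℝ)) atTop atTop)
    (hδ : ∀ k, (Fintype.card (I k) : ℝ) - Fintype.card (J k) = δ) {A : ∀ k, I k → Set (Ω k)}
    (hA : ∀ k i ω, ∑ j, x k i j ω ≠ 0 → (ω ∈ A k i ↔ 0 ≤ surplus (fun i j => x k i j ω) i)) :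
    Tendsto (fun k => (∫ ω, |∑ i, ((A k i).indicator 1 ω -
        stdNormalCDF (1 + p * δ / (2 * (1 - p))))| ∂(μ k)) /
      (Fintype.card (I k) + Fintype.card (J k))) atTop (𝓝 0) := by
  classical
  set L := stdNormalCDF (1 + p * δ / (2 * (1 - p))) with hL
  set g : ∀ k, I k → I k → ℝ := fun k i i' =>
    ∫ ω, ((A k i).indicator 1 ω - L) * ((A k i').indicator 1 ω - L) ∂(μ k) with hg
  -- uniformity over the pairs of rows: the limit holds along the pairs with the worst value
  have hunif : ∀ η : ℝ, 0 < η → ∀ᶠ k in atTop, ∀ i i' : I k, i ≠ i' → |g k i i'| ≤ η := by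
    intro η hη
    have hex : ∀ k, ∃ q : I k × I k, q.1 ≠ q.2 ∧
        ((∃ i i' : I k, i ≠ i' ∧ η < |g k i i'|) → η < |g k q.1 q.2|) := fun k => by
      by_cases hbad : ∃ i i' : I k, i ≠ i' ∧ η < |g k i i'|
      · obtain ⟨i, i', h1, h2⟩ := hbad
        exact ⟨(i, i'), h1, fun _ => h2⟩
      · obtain ⟨i, i', h1⟩ := exists_pair_ne (I k)
        exact ⟨(i, i'), h1, fun hc => absurd hc hbad⟩
    choose q hq1 hq2 using hex
    have hlim := tendsto_integral_indicator_sub_mul_indicator_sub h hp₀ hp₁ hn hδ hA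
      (i := fun k => (q k).1) (i' := fun k => (q k).2) hq1
    have hev := hlim.abs.eventually_le_const (u := η) (by simpa using hη)
    filter_upwards [hev] with k hk i i' hii
    by_contra hcon
    exact absurd (hq2 k ⟨i, i', hii, not_le.1 hcon⟩) (not_lt.2 hk)
  have hinv : Tendsto (fun k => (Fintype.card (I k) : ℝ)⁻¹) atTop (𝓝 0) :=
    tendsto_inv_atTop_zero.comp hm
  refine tendsto_order.2 ⟨fun a ha => Eventually.of_forall fun k => ha.trans_le ?_,
    fun ε hε => ?_⟩
  · exact div_nonneg (integral_nonneg fun _ => abs_nonneg _) (by positivity)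
  · have hη : 0 < ε ^ 2 / 2 := by positivity
    filter_upwards [hunif _ hη, hinv.eventually_lt_const hη] with k hk hk'
    have hmk : (0 : ℝ) < Fintype.card (I k) := by exact_mod_cast Fintype.card_pos
    have hnk : (0 : ℝ) ≤ Fintype.card (J k) := Nat.cast_nonneg _
    have h1 := integral_abs_sum_indicator_sub_le (A := A k) (stdNormalCDF_nonneg _)
      (stdNormalCDF_le_one _) hη.le hk
    rw [div_lt_iff₀ (by positivity)]
    refine h1.trans_lt ?_
    have h2 : (Fintype.card (I k) : ℝ) < (Fintype.card (I k) : ℝ) ^ 2 * (ε ^ 2 / 2) := by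
      rw [inv_lt_iff_one_lt_mul₀ hmk] at hk'
      nlinarith
    calc √(Fintype.card (I k) + (Fintype.card (I k) : ℝ) ^ 2 * (ε ^ 2 / 2))
        < √((ε * Fintype.card (I k)) ^ 2) :=
          Real.sqrt_lt_sqrt (by positivity) (by nlinarith)
      _ = ε * Fintype.card (I k) := Real.sqrt_sq (by positivity)
      _ ≤ _ := by gcongr; linarith

end Sequences

/-! ### Groupies of a bipartite graph in terms of its biadjacency matrix -/

open Classical in
/-- The biadjacency matrix of the bipartite graph with edge set `E`. -/
noncomputable def biadjacency {I J : Type*} (i : I) (j : J) (E : Set (I × J)) : ℝ :=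
  if (i, j) ∈ E then 1 else 0

section Graph

variable {n₁ n₂ : ℕ} (E : Set (Fin n₁ × Fin n₂)) [DecidableRel (bipartiteGraph E).Adj]

theorem sum_neighborFinset_inl (i : Fin n₁) (f : Fin n₁ ⊕ Fin n₂ → ℝ) :
    ∑ w ∈ (bipartiteGraph E).neighborFinset (Sum.inl i), f w =
      ∑ j, biadjacency i j E * f (Sum.inr j) := by
  rw [SimpleGraph.neighborFinset_eq_filter, Finset.sum_filter, Fintype.sum_sum_type]
  rw [Finset.sum_eq_zero fun l _ => if_neg
    (show ¬(bipartiteGraph E).Adj (Sum.inl i) (Sum.inl l) from id), zero_add]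
  refine Finset.sum_congr rfl fun j _ => ?_
  by_cases h : (i, j) ∈ E
  · rw [if_pos (show (bipartiteGraph E).Adj (Sum.inl i) (Sum.inr j) from h), biadjacency, if_pos h,
      one_mul]
  · rw [if_neg (show ¬(bipartiteGraph E).Adj (Sum.inl i) (Sum.inr j) from h), biadjacency,
      if_neg h, zero_mul]

theorem sum_neighborFinset_inr (j : Fin n₂) (f : Fin n₁ ⊕ Fin n₂ → ℝ) :
    ∑ w ∈ (bipartiteGraph E).neighborFinset (Sum.inr j), f w =
      ∑ i, biadjacency i j E * f (Sum.inl i) := by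
  rw [SimpleGraph.neighborFinset_eq_filter, Finset.sum_filter, Fintype.sum_sum_type]
  rw [add_comm, Finset.sum_eq_zero fun l _ => if_neg
    (show ¬(bipartiteGraph E).Adj (Sum.inr j) (Sum.inr l) from id), zero_add]
  refine Finset.sum_congr rfl fun i _ => ?_
  by_cases h : (i, j) ∈ E
  · rw [if_pos (show (bipartiteGraph E).Adj (Sum.inr j) (Sum.inl i) from h), biadjacency, if_pos h,
      one_mul]
  · rw [if_neg (show ¬(bipartiteGraph E).Adj (Sum.inr j) (Sum.inl i) from h), biadjacency,
      if_neg h, zero_mul]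

theorem degree_inl (i : Fin n₁) :
    ((bipartiteGraph E).degree (Sum.inl i) : ℝ) = ∑ j, biadjacency i j E := by
  have := sum_neighborFinset_inl E i fun _ => 1
  simpa using this

theorem degree_inr (j : Fin n₂) :
    ((bipartiteGraph E).degree (Sum.inr j) : ℝ) = ∑ i, biadjacency i j E := by
  have := sum_neighborFinset_inr E j fun _ => 1
  simpa using this

theorem averageDegree_bipartiteGraph :
    averageDegree (bipartiteGraph E) = 2 * (∑ j, ∑ i, biadjacency i j E) / (n₁ + n₂) := by
  rw [averageDegree, Fintype.sum_sum_type]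
  simp_rw [degree_inl, degree_inr]
  rw [Finset.sum_comm]
  simp [two_mul]

/-- A vertex that is not isolated is a groupie exactly when its surplus is nonnegative. -/
theorem isGroupie_inl_iff (i : Fin n₁) (h : ∑ j, biadjacency i j E ≠ 0) :
    IsGroupie (bipartiteGraph E) (Sum.inl i) ↔ 0 ≤ surplus (fun i j => biadjacency i j E) i := by
  have hd : (bipartiteGraph E).degree (Sum.inl i) ≠ 0 := fun h0 => h (by
    rw [← degree_inl, h0, Nat.cast_zero])
  have hpos : (0 : ℝ) < (bipartiteGraph E).degree (Sum.inl i) := by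
    exact_mod_cast Nat.pos_of_ne_zero hd
  rw [IsGroupie, if_neg hd, le_div_iff₀ hpos, neighborDegreeSum, Nat.cast_sum,
    sum_neighborFinset_inl, averageDegree_bipartiteGraph, degree_inl, surplus, sub_nonneg,
    Fintype.card_fin, Fintype.card_fin, div_mul_eq_mul_div]
  simp_rw [degree_inr]

theorem isGroupie_inr_iff (j : Fin n₂) (h : ∑ i, biadjacency i j E ≠ 0) :
    IsGroupie (bipartiteGraph E) (Sum.inr j) ↔ 0 ≤ surplus (fun j i => biadjacency i j E) j := by
  have hd : (bipartiteGraph E).degree (Sum.inr j) ≠ 0 := fun h0 => h (by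
    rw [← degree_inr, h0, Nat.cast_zero])
  have hpos : (0 : ℝ) < (bipartiteGraph E).degree (Sum.inr j) := by
    exact_mod_cast Nat.pos_of_ne_zero hd
  rw [IsGroupie, if_neg hd, le_div_iff₀ hpos, neighborDegreeSum, Nat.cast_sum,
    sum_neighborFinset_inr, averageDegree_bipartiteGraph, degree_inr, surplus, sub_nonneg,
    Fintype.card_fin, Fintype.card_fin, div_mul_eq_mul_div, Finset.sum_comm, add_comm (n₁ : ℝ)]
  simp_rw [degree_inl]

end Graph

open Classical in
/-- The event, as a set of edge sets, that the vertex `v` is a groupie. -/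
def groupieEvent {n₁ n₂ : ℕ} (v : Fin n₁ ⊕ Fin n₂) : Set (Set (Fin n₁ × Fin n₂)) :=
  {E | IsGroupie (bipartiteGraph E) v}

/-- The groupies are counted separately in the two parts, each against its own proportion. -/
theorem abs_groupieProportion_sub_le {n₁ n₂ : ℕ} (hn : 0 < n₁ + n₂) (E : Set (Fin n₁ × Fin n₂))
    (L₁ L₂ : ℝ) :
    |groupieProportion (bipartiteGraph E) - (n₁ * L₁ + n₂ * L₂) / (n₁ + n₂)| ≤
      |∑ i, ((groupieEvent (Sum.inl i : Fin n₁ ⊕ Fin n₂)).indicator 1 E - L₁)| / (n₁ + n₂) +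
      |∑ j, ((groupieEvent (Sum.inr j : Fin n₁ ⊕ Fin n₂)).indicator 1 E - L₂)| / (n₂ + n₁) := by
  classical
  have hN : (0 : ℝ) < n₁ + n₂ := by exact_mod_cast hn
  have e : groupieProportion (bipartiteGraph E) =
      (∑ i, (groupieEvent (Sum.inl i : Fin n₁ ⊕ Fin n₂)).indicator 1 E +
        ∑ j, (groupieEvent (Sum.inr j : Fin n₁ ⊕ Fin n₂)).indicator 1 E) / (n₁ + n₂) := by
    rw [groupieProportion, Finset.card_filter, Nat.cast_sum, Fintype.sum_sum_type]
    simp only [groupieEvent, Set.indicator, Set.mem_ofPred_eq, Pi.one_apply, Nat.cast_ite,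
      Nat.cast_one, Nat.cast_zero, Fintype.card_sum, Fintype.card_fin, Nat.cast_add]
    congr
  rw [e, add_comm (n₂ : ℝ), ← add_div, ← sub_div, abs_div, abs_of_pos hN]
  refine div_le_div_of_nonneg_right (le_trans (le_of_eq ?_) (abs_add_le _ _)) hN.le
  congr 1
  simp only [Finset.sum_sub_distrib, Finset.sum_const, Finset.card_univ, Fintype.card_fin,
    nsmul_eq_mul]
  ring

/-! ### The random bipartite graph -/

theorem isBernoulliMatrix_biadjacency (n₁ n₂ : ℕ) (p : unitInterval) :
    IsBernoulliMatrix (setBernoulli (Set.univ : Set (Fin n₁ × Fin n₂)) p) (p : ℝ)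
      (biadjacency : Fin n₁ → Fin n₂ → Set (Fin n₁ × Fin n₂) → ℝ) := by
  classical
  let ν : Fin n₁ × Fin n₂ → Measure Prop := fun a =>
    unitInterval.toNNReal p • Measure.dirac (a ∈ (Set.univ : Set (Fin n₁ × Fin n₂))) +
      unitInterval.toNNReal (unitInterval.symm p) • Measure.dirac False
  let f : (Fin n₁ × Fin n₂ → Prop) → Set (Fin n₁ × Fin n₂) := fun q => {a | q a}
  let b : Prop → ℝ := fun q => if q then 1 else 0
  have hμ : setBernoulli (Set.univ : Set (Fin n₁ × Fin n₂)) p = (Measure.infinitePi ν).map f :=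
    setBernoulli_eq_map _ _
  have hf : Measurable f := MeasurableEquiv.setOfPred.measurable
  have hx : ∀ a : Fin n₁ × Fin n₂, Measurable (biadjacency a.1 a.2) := fun a =>
    Measurable.of_discrete
  have hxf : ∀ a : Fin n₁ × Fin n₂, biadjacency a.1 a.2 ∘ f = fun q => b (q a) := fun a => rfl
  refine ⟨fun i j E => ?_, ?_, fun i j => ?_⟩
  · unfold biadjacency
    split_ifs <;> simp
  · rw [iIndepFun_iff_map_fun_eq_infinitePi_map hx, hμ, Measure.map_map (by fun_prop) hf]
    have h1 : ∀ a : Fin n₁ × Fin n₂, ((Measure.infinitePi ν).map f).map (biadjacency a.1 a.2) =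
        (Measure.infinitePi ν).map (fun q => b (q a)) := fun a => by
      rw [Measure.map_map (hx a) hf, hxf]
    simp_rw [h1]
    exact (iIndepFun_infinitePi (P := ν) (X := fun _ => b)
      fun _ => Measurable.of_discrete).map_fun_eq_infinitePi_map fun a => Measurable.of_discrete
  · rw [hμ, integral_map hf.aemeasurable (hx (i, j)).aestronglyMeasurable]
    change ∫ q, b (q (i, j)) ∂(Measure.infinitePi ν) = p
    rw [← integral_map (φ := fun q : Fin n₁ × Fin n₂ → Prop => q (i, j)) (f := b)
      (measurable_pi_apply (i, j)).aemeasurable (Measurable.of_discrete.aestronglyMeasurable),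
      Measure.infinitePi_map_eval]
    simp only [ν]
    rw [integral_add_measure Integrable.of_finite Integrable.of_finite,
      integral_smul_nnreal_measure, integral_smul_nnreal_measure, integral_dirac, integral_dirac]
    simp [b, NNReal.smul_def]

theorem measurableSet_simpleGraph {V : Type*} [Finite V] (S : Set (SimpleGraph V)) :
    MeasurableSet S := by
  rw [← Set.preimage_image_eq S SimpleGraph.edgeSet_injective]
  exact SimpleGraph.measurable_edgeSet (Set.toFinite _).measurableSet

/-- Convergence in mean implies convergence in probability. The centring `c k` may depend on `k`. -/
theorem groupieProportionTendsto_of_tendsto_integral {p : unitInterval} {n₁ n₂ : ℕ → ℕ} {L : ℝ}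
    {c : ℕ → ℝ} (hc : Tendsto c atTop (𝓝 L))
    (h : Tendsto (fun k => ∫ E, |groupieProportion (bipartiteGraph E) - c k|
      ∂(setBernoulli (Set.univ : Set (Fin (n₁ k) × Fin (n₂ k))) p)) atTop (𝓝 0)) :
    GroupieProportionTendsto p n₁ n₂ L := by
  intro ε hε
  have h2 : Tendsto (fun k => ENNReal.ofReal ((∫ E, |groupieProportion (bipartiteGraph E) - c k|
      ∂(setBernoulli (Set.univ : Set (Fin (n₁ k) × Fin (n₂ k))) p)) / (ε / 2))) atTop (𝓝 0) := by
    simpa using ENNReal.tendsto_ofReal (h.div_const (ε / 2))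
  have hnear : ∀ᶠ k in atTop, |c k - L| < ε / 2 := by
    have := (hc.sub_const L).abs
    simp only [sub_self, abs_zero] at this
    exact this.eventually_lt_const (by positivity)
  refine tendsto_of_tendsto_of_tendsto_of_le_of_le' tendsto_const_nhds h2
    (Eventually.of_forall fun _ => zero_le) ?_
  filter_upwards [hnear] with k hk
  rw [randomBipartite, Measure.map_apply measurable_bipartiteGraph (measurableSet_simpleGraph _)]
  refine (measure_mono (fun E hE => ?_)).trans
    ((ENNReal.le_ofReal_iff_toReal_le (measure_ne_top _ _) (by positivity)).2
      (measureReal_abs_ge_le (by positivity) fun E => groupieProportion (bipartiteGraph E) - c k))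
  have h1 : ε < |groupieProportion (bipartiteGraph E) - L| := hE
  have h3 := abs_sub_le (groupieProportion (bipartiteGraph E)) (c k) L
  change ε / 2 ≤ _
  linarith

/-! ### The limit as a function of the difference of the part sizes -/

theorem stdNormalCDF_sub (a b : ℝ) :
    stdNormalCDF b - stdNormalCDF a = ∫ t in a..b, gaussianPDFReal 0 1 t := by
  have h : ∀ y, stdNormalCDF y = ∫ t in Set.Iic y, gaussianPDFReal 0 1 t := fun y => by
    rw [stdNormalCDF, cdf_eq_real, measureReal_def, gaussianReal_apply_eq_integral _ one_ne_zero,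
      ENNReal.toReal_ofReal]
    exact integral_nonneg fun t => gaussianPDFReal_nonneg 0 1 t
  rw [h, h]
  exact intervalIntegral.integral_Iic_sub_Iic (integrable_gaussianPDFReal 0 1).integrableOn
    (integrable_gaussianPDFReal 0 1).integrableOn

/-- Moving away from `1` symmetrically loses more mass on the left, which is closer to the mode of
the normal density, than it gains on the right. -/
theorem stdNormalCDF_add_lt {x y : ℝ} (hx : 0 ≤ x) (hxy : x < y) :
    stdNormalCDF (1 + y) + stdNormalCDF (1 - y) < stdNormalCDF (1 + x) + stdNormalCDF (1 - x) := by
  have h1 := stdNormalCDF_sub (1 + x) (1 + y)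
  have h2 := stdNormalCDF_sub (1 - y) (1 - x)
  rw [← intervalIntegral.integral_comp_add_left (fun t => gaussianPDFReal 0 1 t)] at h1
  rw [← intervalIntegral.integral_comp_sub_left (fun t => gaussianPDFReal 0 1 t)] at h2
  have hcont : Continuous (gaussianPDFReal 0 1) := by
    rw [gaussianPDFReal_def]
    fun_prop
  have hle : ∀ s, 0 ≤ s → gaussianPDFReal 0 1 (1 + s) ≤ gaussianPDFReal 0 1 (1 - s) :=
    fun s hs => by
      simp only [gaussianPDFReal_def]
      gcongr ?_ * Real.exp (?_ / ?_)
      nlinarith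
  have hlt : gaussianPDFReal 0 1 (1 + y) < gaussianPDFReal 0 1 (1 - y) := by
    simp only [gaussianPDFReal_def]
    gcongr ?_ * Real.exp (?_ / ?_)
    nlinarith
  have h3 : ∫ s in x..y, gaussianPDFReal 0 1 (1 + s) < ∫ s in x..y, gaussianPDFReal 0 1 (1 - s) :=
    intervalIntegral.integral_lt_integral_of_continuousOn_of_le_of_exists_lt hxy
      (hcont.comp (by fun_prop)).continuousOn (hcont.comp (by fun_prop)).continuousOn
      (fun s hs => hle s (hx.trans hs.1.le)) ⟨y, Set.right_mem_Icc.2 hxy.le, hlt⟩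
  linarith

theorem balancedLimit_eq_abs (p : ℝ) (c : ℤ) :
    balancedLimit p c = (1 / 2) * (stdNormalCDF (1 + p / (2 * (1 - p)) * (|c| : ℤ)) +
      stdNormalCDF (1 - p / (2 * (1 - p)) * (|c| : ℤ))) := by
  rw [balancedLimit]
  rcases abs_choice c with h | h <;> rw [h]
  · rw [mul_div_right_comm]
  · rw [mul_div_right_comm, Int.cast_neg, mul_neg, sub_neg_eq_add, ← sub_eq_add_neg, add_comm]

theorem tendsto_balancedLimit {p : ℝ} (hp₀ : 0 < p) (hp₁ : p < 1) :
    Tendsto (fun c : ℤ => balancedLimit p c) (comap (fun c : ℤ => |c|) atTop) (𝓝 (1 / 2)) := by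
  have hK : 0 < p / (2 * (1 - p)) := div_pos hp₀ (by linarith)
  have habs : Tendsto (fun c : ℤ => p / (2 * (1 - p)) * ((|c| : ℤ) : ℝ))
      (comap (fun c : ℤ => |c|) atTop) atTop :=
    (tendsto_intCast_atTop_atTop.comp tendsto_comap).const_mul_atTop hK
  have h1 : Tendsto (fun c : ℤ => stdNormalCDF (1 + p / (2 * (1 - p)) * ((|c| : ℤ) : ℝ)))
      (comap (fun c : ℤ => |c|) atTop) (𝓝 1) :=
    (tendsto_cdf_atTop _).comp (tendsto_atTop_add_const_left _ 1 habs)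
  have h2 : Tendsto (fun c : ℤ => stdNormalCDF (1 - p / (2 * (1 - p)) * ((|c| : ℤ) : ℝ)))
      (comap (fun c : ℤ => |c|) atTop) (𝓝 0) := by
    refine (tendsto_cdf_atBot _).comp ?_
    simp_rw [sub_eq_add_neg]
    exact tendsto_atBot_add_const_left _ 1 (tendsto_neg_atTop_atBot.comp habs)
  simp_rw [balancedLimit_eq_abs]
  have h3 := (h1.add h2).const_mul (1 / 2 : ℝ)
  rwa [add_zero, mul_one] at h3

/-! ### Convergence of the proportion of groupies -/

theorem integral_abs_groupieProportion_sub_le {n₁ n₂ : ℕ} (hn : 0 < n₁ + n₂)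
    (μ : Measure (Set (Fin n₁ × Fin n₂))) [IsProbabilityMeasure μ] (L₁ L₂ : ℝ) :
    ∫ E, |groupieProportion (bipartiteGraph E) - (n₁ * L₁ + n₂ * L₂) / (n₁ + n₂)| ∂μ ≤
      (∫ E, |∑ i, ((groupieEvent (Sum.inl i : Fin n₁ ⊕ Fin n₂)).indicator 1 E - L₁)| ∂μ) /
        (n₁ + n₂) +
      (∫ E, |∑ j, ((groupieEvent (Sum.inr j : Fin n₁ ⊕ Fin n₂)).indicator 1 E - L₂)| ∂μ) /
        (n₂ + n₁) := by
  rw [← integral_div, ← integral_div, ← integral_add Integrable.of_finite Integrable.of_finite]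
  exact integral_mono Integrable.of_finite Integrable.of_finite fun E =>
    abs_groupieProportion_sub_le hn E L₁ L₂

/-- Almost all vertices of the larger part and almost none of the smaller part are groupies, so the
proportion is asymptotically `max n₁ n₂ / (n₁ + n₂)`. -/
theorem groupieProportionTendsto_unbalanced (p : unitInterval) (hp₀ : 0 < p)
    {n₁ n₂ : ℕ → ℕ} {α : ℝ}
    (h₁ : Tendsto n₁ atTop atTop) (h₂ : Tendsto n₂ atTop atTop)
    (hα : Tendsto (fun k => (n₁ k : ℝ) / (n₂ k : ℝ)) atTop (𝓝 α))
    (hd : Tendsto (fun k => |(n₁ k : ℤ) - (n₂ k : ℤ)|) atTop atTop) :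
    GroupieProportionTendsto p n₁ n₂ (max 1 α / (1 + α)) := by
  classical
  have hp₀' : (0 : ℝ) < p := hp₀
  have hp₁' : (p : ℝ) ≤ 1 := p.2.2
  have hα₀ : 0 ≤ α := ge_of_tendsto' hα fun k => by positivity
  have r₁ : Tendsto (fun k => (n₁ k : ℝ)) atTop atTop := tendsto_natCast_atTop_atTop.comp h₁
  have r₂ : Tendsto (fun k => (n₂ k : ℝ)) atTop atTop := tendsto_natCast_atTop_atTop.comp h₂
  have rd : Tendsto (fun k => |(n₁ k : ℝ) - n₂ k|) atTop atTop := by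
    have : Tendsto (fun k => ((|(n₁ k : ℤ) - (n₂ k : ℤ)| : ℤ) : ℝ)) atTop atTop :=
      tendsto_intCast_atTop_atTop.comp hd
    simpa using this
  have hev : ∀ᶠ k in atTop, 0 < n₁ k ∧ 0 < n₂ k ∧ n₁ k ≠ n₂ k := by
    filter_upwards [h₁.eventually_gt_atTop 0, h₂.eventually_gt_atTop 0, hd.eventually_gt_atTop 0]
      with k k1 k2 k3
    refine ⟨k1, k2, fun h => ?_⟩
    simp [h] at k3
  refine groupieProportionTendsto_of_tendsto_integral
    (c := fun k => (n₁ k * (if n₂ k < n₁ k then (1 : ℝ) else 0) +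
      n₂ k * (if n₁ k < n₂ k then (1 : ℝ) else 0)) / (n₁ k + n₂ k)) ?_ ?_
  · have hlim : Tendsto (fun k => max 1 ((n₁ k : ℝ) / n₂ k) / (1 + (n₁ k : ℝ) / n₂ k)) atTop
        (𝓝 (max 1 α / (1 + α))) :=
      (tendsto_const_nhds.max hα).div (tendsto_const_nhds.add hα) (by positivity)
    refine hlim.congr' ?_
    filter_upwards [hev] with k ⟨k1, k2, k3⟩
    have c1 : (0 : ℝ) < n₁ k := by exact_mod_cast k1
    have c2 : (0 : ℝ) < n₂ k := by exact_mod_cast k2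
    rcases lt_or_gt_of_ne k3 with hlt | hlt
    · have hle : (n₁ k : ℝ) / n₂ k ≤ 1 := (div_le_one c2).2 (by exact_mod_cast hlt.le)
      rw [max_eq_left hle, if_neg (by omega), if_pos hlt]
      field_simp
      ring
    · have hle : 1 ≤ (n₁ k : ℝ) / n₂ k := (one_le_div c2).2 (by exact_mod_cast hlt.le)
      rw [max_eq_right hle, if_pos hlt, if_neg (by omega)]
      field_simp
      ring
  · have hB : ∀ m n : ℕ → ℝ, Tendsto m atTop atTop → Tendsto n atTop atTop →
        Tendsto (fun k => |m k - n k|) atTop atTop →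
        Tendsto (fun k => 2 / (p * √(n k)) + 2 / (p * √(n k * m k)) +
          12 / (p : ℝ) ^ 2 * (2 / |m k - n k| + 1 / n k)) atTop (𝓝 0) := by
      intro m n hm hn hmn
      have b1 : Tendsto (fun k => 2 / (p * √(n k))) atTop (𝓝 0) :=
        tendsto_const_nhds.div_atTop ((Real.tendsto_sqrt_atTop.comp hn).const_mul_atTop hp₀')
      have b2 : Tendsto (fun k => 2 / (p * √(n k * m k))) atTop (𝓝 0) :=
        tendsto_const_nhds.div_atTop
          ((Real.tendsto_sqrt_atTop.comp (hn.atTop_mul_atTop₀ hm)).const_mul_atTop hp₀')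
      have b3 : Tendsto (fun k => 2 / |m k - n k|) atTop (𝓝 0) := tendsto_const_nhds.div_atTop hmn
      have b4 : Tendsto (fun k => 1 / n k) atTop (𝓝 0) := tendsto_const_nhds.div_atTop hn
      simpa using (b1.add b2).add ((b3.add b4).const_mul (12 / (p : ℝ) ^ 2))
    have rd' : Tendsto (fun k => |(n₂ k : ℝ) - n₁ k|) atTop atTop := by
      simpa only [abs_sub_comm] using rd
    have hsum := (hB _ _ r₁ r₂ rd).add (hB _ _ r₂ r₁ rd')
    rw [add_zero] at hsum
    refine tendsto_of_tendsto_of_tendsto_of_le_of_le' tendsto_const_nhds hsum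
      (Eventually.of_forall fun k => integral_nonneg fun _ => abs_nonneg _) ?_
    filter_upwards [hev] with k ⟨k1, k2, k3⟩
    have : NeZero (n₁ k) := ⟨k1.ne'⟩
    have : NeZero (n₂ k) := ⟨k2.ne'⟩
    have hX := isBernoulliMatrix_biadjacency (n₁ k) (n₂ k) p
    have e1 := hX.integral_abs_sum_indicator_sub_ite_div_le hp₀' hp₁'
      (A := fun i => groupieEvent (Sum.inl i))
      (fun i E hE => isGroupie_inl_iff E i hE) (by simpa using k3)
    have e2 := hX.transpose.integral_abs_sum_indicator_sub_ite_div_le hp₀' hp₁'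
      (A := fun j => groupieEvent (Sum.inr j))
      (fun j E hE => isGroupie_inr_iff E j hE) (by simpa using k3.symm)
    simp only [Fintype.card_fin] at e1 e2
    exact (integral_abs_groupieProportion_sub_le (by omega) _ _ _).trans (add_le_add e1 e2)

/-- In a part with `δ = ± c` more vertices than the other, the proportion of groupies tends to
`Φ (1 + p δ / (2 (1 - p)))`; both parts have asymptotically half of the vertices. -/
theorem groupieProportionTendsto_balanced (p : unitInterval) (hp₀ : 0 < p) (hp₁ : p < 1)
    {n₁ n₂ : ℕ → ℕ} {c : ℤ} (h₁ : Tendsto n₁ atTop atTop) (h₂ : Tendsto n₂ atTop atTop)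
    (hc : ∀ k, (n₁ k : ℤ) - (n₂ k : ℤ) = c) :
    GroupieProportionTendsto p n₁ n₂ (balancedLimit p c) := by
  classical
  -- the parts have two vertices from some index on, and finitely many indices do not matter
  wlog hge : ∀ k, 2 ≤ n₁ k ∧ 2 ≤ n₂ k generalizing n₁ n₂
  · obtain ⟨k₀, hk₀⟩ := eventually_atTop.1
      ((h₁.eventually_ge_atTop 2).and (h₂.eventually_ge_atTop 2))
    intro ε hε
    have hs := tendsto_add_atTop_nat k₀
    have := this (n₁ := fun k => n₁ (k + k₀)) (n₂ := fun k => n₂ (k + k₀)) (h₁.comp hs)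
      (h₂.comp hs) (fun k => hc _) (fun k => hk₀ _ (Nat.le_add_left _ _)) ε hε
    exact (tendsto_add_atTop_iff_nat (f := fun k =>
      randomBipartite (n₁ k) (n₂ k) p {G | ε < |groupieProportion G - balancedLimit p c|}) k₀).1
        this
  have hp₀' : (0 : ℝ) < p := hp₀
  have hp₁' : (p : ℝ) < 1 := hp₁
  have r₁ : Tendsto (fun k => (n₁ k : ℝ)) atTop atTop := tendsto_natCast_atTop_atTop.comp h₁
  have r₂ : Tendsto (fun k => (n₂ k : ℝ)) atTop atTop := tendsto_natCast_atTop_atTop.comp h₂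
  have hcr : ∀ k, (n₁ k : ℝ) - n₂ k = c := fun k => by
    exact_mod_cast congrArg (Int.cast (R := ℝ)) (hc k)
  have hnt₁ : ∀ k, Nontrivial (Fin (n₁ k)) := fun k => Fin.nontrivial_iff_two_le.2 (hge k).1
  have hnt₂ : ∀ k, Nontrivial (Fin (n₂ k)) := fun k => Fin.nontrivial_iff_two_le.2 (hge k).2
  have hX := fun k => isBernoulliMatrix_biadjacency (n₁ k) (n₂ k) p
  have e1 := tendsto_integral_abs_sum_indicator_sub_div (δ := (c : ℝ)) hX hp₀' hp₁'
    (by simpa using r₁) (by simpa using r₂) (by simpa using hcr)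
    (A := fun k i => groupieEvent (Sum.inl i)) (fun k i E hE => isGroupie_inl_iff E i hE)
  have e2 := tendsto_integral_abs_sum_indicator_sub_div (δ := -(c : ℝ))
    (fun k => (hX k).transpose) hp₀' hp₁'
    (by simpa using r₂) (by simpa using r₁)
    (fun k => by simp only [Fintype.card_fin]; linarith [hcr k])
    (A := fun k j => groupieEvent (Sum.inr j)) (fun k j E hE => isGroupie_inr_iff E j hE)
  simp only [Fintype.card_fin] at e1 e2
  set L₁ := stdNormalCDF (1 + p * (c : ℝ) / (2 * (1 - p)))
  set L₂ := stdNormalCDF (1 + p * (-(c : ℝ)) / (2 * (1 - p)))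
  refine groupieProportionTendsto_of_tendsto_integral
    (c := fun k => (n₁ k * L₁ + n₂ k * L₂) / (n₁ k + n₂ k)) ?_ ?_
  · have hinv : Tendsto (fun k => ((n₁ k : ℝ) + n₂ k)⁻¹) atTop (𝓝 0) :=
      tendsto_inv_atTop_zero.comp (r₁.atTop_add_atTop r₂)
    -- the weighted mean differs from `(L₁ + L₂) / 2` by `c (L₁ - L₂) / (2 (n₁ + n₂))`
    have hlim := (hinv.const_mul ((c : ℝ) / 2 * (L₁ - L₂))).const_add ((1 / 2) * (L₁ + L₂))
    have hL : balancedLimit p c = (1 / 2) * (L₁ + L₂) +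
        (c : ℝ) / 2 * (L₁ - L₂) * 0 := by
      have hL₂ : L₂ = stdNormalCDF (1 - p * (c : ℝ) / (2 * (1 - p))) := by
        simp only [L₂, mul_neg, neg_div, ← sub_eq_add_neg]
      rw [hL₂, balancedLimit, mul_zero, add_zero]
    rw [hL]
    refine hlim.congr fun k => ?_
    have c1 : (0 : ℝ) < n₁ k := by exact_mod_cast lt_of_lt_of_le two_pos (hge k).1
    have c2 : (0 : ℝ) < n₂ k := by exact_mod_cast lt_of_lt_of_le two_pos (hge k).2
    rw [← hcr k]
    field_simp
    ring
  · have hsum := e1.add e2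
    rw [add_zero] at hsum
    exact squeeze_zero (fun k => integral_nonneg fun _ => abs_nonneg _)
      (fun k => integral_abs_groupieProportion_sub_le
        (lt_of_lt_of_le two_pos ((hge k).1.trans (Nat.le_add_right _ _))) _ _ _) hsum

end GroupieBipartite

theorem mainTheorem2 (p : unitInterval) (hp₀ : 0 < p) (hp₁ : p < 1) :
    (∀ (n₁ n₂ : ℕ → ℕ) (α : ℝ), Tendsto n₁ atTop atTop → Tendsto n₂ atTop atTop →
      Tendsto (fun k => (n₁ k : ℝ) / (n₂ k : ℝ)) atTop (𝓝 α) →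
      Tendsto (fun k => |(n₁ k : ℤ) - (n₂ k : ℤ)|) atTop atTop →
      GroupieBipartite.GroupieProportionTendsto p n₁ n₂ (max 1 α / (1 + α))) ∧
    (∀ (n₁ n₂ : ℕ → ℕ) (c : ℤ), Tendsto n₁ atTop atTop → Tendsto n₂ atTop atTop →
      (∀ k, (n₁ k : ℤ) - (n₂ k : ℤ) = c) →
      GroupieBipartite.GroupieProportionTendsto p n₁ n₂ (GroupieBipartite.balancedLimit p c)) ∧
    (∀ c c' : ℤ, |c| = |c'| →
      GroupieBipartite.balancedLimit p c = GroupieBipartite.balancedLimit p c') ∧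
    (∀ c c' : ℤ, |c| < |c'| →
      GroupieBipartite.balancedLimit p c' < GroupieBipartite.balancedLimit p c) ∧
    GroupieBipartite.balancedLimit p 0 = GroupieBipartite.stdNormalCDF 1 ∧
    Tendsto (fun c : ℤ => GroupieBipartite.balancedLimit p c)
      (comap (fun c : ℤ => |c|) atTop) (𝓝 (1 / 2)) := by
  have hp₀' : (0 : ℝ) < p := hp₀
  have hp₁' : (p : ℝ) < 1 := hp₁
  refine ⟨fun n₁ n₂ α h₁ h₂ hα hd =>
      GroupieBipartite.groupieProportionTendsto_unbalanced p hp₀ h₁ h₂ hα hd,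
    fun n₁ n₂ c h₁ h₂ hc =>
      GroupieBipartite.groupieProportionTendsto_balanced p hp₀ hp₁ h₁ h₂ hc,
    fun c c' h => ?_, fun c c' h => ?_, ?_, GroupieBipartite.tendsto_balancedLimit hp₀' hp₁'⟩
  · rw [GroupieBipartite.balancedLimit_eq_abs, h,
      ← GroupieBipartite.balancedLimit_eq_abs]
  · rw [GroupieBipartite.balancedLimit_eq_abs,
      GroupieBipartite.balancedLimit_eq_abs]
    have hK : 0 < (p : ℝ) / (2 * (1 - p)) := div_pos hp₀' (by linarith)
    have hlt : ((|c| : ℤ) : ℝ) < ((|c'| : ℤ) : ℝ) := Int.cast_lt.2 h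
    have h0 : (0 : ℝ) ≤ ((|c| : ℤ) : ℝ) := Int.cast_nonneg (abs_nonneg c)
    exact mul_lt_mul_of_pos_left (GroupieBipartite.stdNormalCDF_add_lt (mul_nonneg hK.le h0)
      (mul_lt_mul_of_pos_left hlt hK)) (by norm_num)
  · simp [GroupieBipartite.balancedLimit]
    ring
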